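/- **Setting.** Let $0=b_0<b_1<\dots<b_K=1$, $I_m=(b_m,b_{m+1})$, and for $\varepsilon>0$ put $I_{m,\varepsilon}=[b_m+\varepsilon,\,b_{m+1}-\varepsilon]$ and $I_\varepsilon=\bigcup_m I_{m,\varepsilon}$. Let $f:[0,1]^2\to[0,1]$ be a symmetric measurable graphon such that, for constants $\eta_0\in(0,1/2)$, $L$, $\eta,\delta>0$ and $\kappa(\varepsilon)>0$ $(\varepsilon>0)$: * (non-degeneracy) $\eta_0\le f\le 1-\eta_0$; * (within-block Lipschitz) $|f(u,x)-f(u',x)|\le L|u-u'|$ for all $m$, $u,u'\in I_m$, $x\in[0,1]$; * (across-block separation) $\lambda\{x: |f(u,x)-f(u',x)|\ge\eta\}\ge\delta$ for $u\in I_m$, $u'\in I_{m'}$, $m\ne m'$, where $\lambda$ is Lebesgue measure; * (within-block identifiability) for every $\varepsilon>0$ and every $m$, $\int_0^1 (f(u,x)-f(u',x))^2\,dx\ge\kappa(\varepsilon)|u-u'|^2$ for all $u\in I_{m,\varepsilon}$ and $u'\in I_m$. Let $\xi_1,\dots,\xi_n$ be i.i.d. uniform on $[0,1]$, $P_{ij}=f(\xi_i,\xi_j)$,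 and, given $\xi$, let $A$ be the adjacency matrix of a simple undirected graph on $\{1,\dots,n\}$ whose edges $A_{ij}$ $(i<j)$ are independent Bernoulli$(P_{ij})$. For $j$ and $i,\ell\neq j$ let $M^{(-j)}_{i\ell}=\frac1{n-1}\sum_{m\ne j}A_{im}A_{m\ell}$, and for distinct $i,k\ne j$ let $d^{(-j)}(i,k)=\max_{\ell\notin\{i,k,j\}}|M^{(-j)}_{i\ell}-M^{(-j)}_{k\ell}|$. For a bandwidth sequence $h_n\in\mathbb N$ with $h_n\asymp\sqrt{n\log n}$, let $\mathcal N_i^{(-j)}$ consist of the $h_n$ vertices $k\notin\{i,j\}$ with the smallest $d^{(-j)}(i,k)$, ties being broken by the smaller index. Put $$\tilde P_{ij}=\frac1{h_n}\sum_{k\in\mathcal N_i^{(-j)}}A_{kj},\qquad s_{ij}^2=\frac1{h_n(h_n-1)}\sum_{k<\ell,\ k,\ell\in\mathcal N_i^{(-j)}}(A_{kj}-A_{\ell j})^2,$$ $$w_{ij}(\alpha)=\sqrt{\frac{2s_{ij}^2\log(4/\alpha)}{h_n}}+\frac{7\log(4/\alpha)}{3(h_n-1)},\qquad \mathrm{CI}_{ij}(\alpha)=[\tilde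 P_{ij}-w_{ij}(\alpha),\,\tilde P_{ij}+w_{ij}(\alpha)]\cap[0,1],$$ $r_n=(\log n/n)^{1/4}$ and $\mathcal E_\varepsilon=\{(i,j): i\ne j,\ \xi_i,\xi_j\in I_\varepsilon\}$. **Theorem.** Fix $\varepsilon>0$ with $2\varepsilon<\min_m(b_{m+1}-b_m)$, $\alpha\in(0,1)$ and $h_n\asymp\sqrt{n\log n}$. There are constants $C,c>0$, depending only on the partition, on $\eta_0,L,\eta,\delta,\kappa$, on $\varepsilon,\alpha$ and on the sequence $(h_n)$, such that for all such $f$ and all $n$ with $2\le h_n\le n-2$: 1. With probability at least $1-n^{-c}$, $$\sup_{(i,j)\in\mathcal E_\varepsilon}\Big|P_{ij}-\frac1{h_n}\sum_{k\in\mathcal N_i^{(-j)}}P_{kj}\Big|\le C\,r_n .$$ 2. For all $i\ne j$, writing $\oplus$ for the Minkowski sum, $$\mathbb P\Big(P_{ij}\in\mathrm{CI}_{ij}(\alpha)\oplus[-Cr_n,Cr_n]\ \Big|\ (i,j)\in\mathcal E_\varepsilon\Big)\ge 1-\alpha-n^{-c}.$$ 3. Both claims also hold conditionally on the latent positions: with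 probability at least $1-n^{-c}$ over $\xi$, the conditional probability given $\xi$ of the event in 1 is at least $1-n^{-c}$, and for every $(i,j)\in\mathcal E_\varepsilon$ the conditional probability given $\xi$ that $P_{ij}\in\mathrm{CI}_{ij}(\alpha)\oplus[-Cr_n,Cr_n]$ is at least $1-\alpha-n^{-c}$. -/

import Mathlib

open MeasureTheory Set
open scoped unitInterval Pointwise

namespace LOO

/-! ### The graphon class -/

/-- The open block `I_m = (b_m, b_{m+1})` of the partition `b`. -/
def block {K : ℕ} (b : Fin (K + 1) → ℝ) (m : Fin K) : Set ℝ :=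
  Ioo (b m.castSucc) (b m.succ)

/-- The part `[b_m + ε, b_{m+1} - ε]` of the block at distance at least `ε` from its ends. -/
def blockInterior {K : ℕ} (b : Fin (K + 1) → ℝ) (ε : ℝ) (m : Fin K) : Set ℝ :=
  Icc (b m.castSucc + ε) (b m.succ - ε)

/-- The regular interior `I_ε`, the union of all block interiors. -/
def regularInterior {K : ℕ} (b : Fin (K + 1) → ℝ) (ε : ℝ) : Set ℝ :=
  ⋃ m : Fin K, blockInterior b ε m

/-- `0 = b_0 < b_1 < ... < b_K = 1`. -/
structure IsPartition {K : ℕ} (b : Fin (K + 1) → ℝ) : Prop where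
  strictMono : StrictMono b
  first : b 0 = 0
  last : b (Fin.last K) = 1

/-- Symmetric measurable graphons on `[0,1]²` that are bounded away from `0` and `1` and piecewise
bi-Lipschitz with respect to the partition `b`, with all the constants displayed.
By symmetry, `lipschitz` also gives Lipschitz continuity in the second argument on each block, so
`f` is Lipschitz in each argument on each open rectangle of the product partition. -/
structure IsBlockGraphon {K : ℕ} (b : Fin (K + 1) → ℝ) (η₀ L η δ : ℝ) (κ : ℝ → ℝ)
    (f : I → I → ℝ) : Prop where
  measurable : Measurable (Function.uncurry f)
  symm : ∀ u v, f u v = f v u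
  nondegenerate : ∀ u v, η₀ ≤ f u v ∧ f u v ≤ 1 - η₀
  /-- within-block Lipschitz continuity in the first argument -/
  lipschitz : ∀ m : Fin K, ∀ u u' : I, (u : ℝ) ∈ block b m → (u' : ℝ) ∈ block b m →
    ∀ x : I, |f u x - f u' x| ≤ L * |(u : ℝ) - u'|
  /-- across-block separation -/
  separated : ∀ m m' : Fin K, m ≠ m' → ∀ u u' : I,
    (u : ℝ) ∈ block b m → (u' : ℝ) ∈ block b m' →
    δ ≤ (volume : Measure I).real {x : I | η ≤ |f u x - f u' x|}
  /-- within-block `L²` identifiability: the rows of a point of the block interior and of any other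
  point of the same block are separated -/
  identifiable : ∀ ε : ℝ, 0 < ε → ∀ m : Fin K, ∀ u u' : I,
    (u : ℝ) ∈ blockInterior b ε m → (u' : ℝ) ∈ block b m →
    κ ε * |(u : ℝ) - u'| ^ 2 ≤ ∫ x : I, (f u x - f u' x) ^ 2

/-! ### The random graph -/

variable {n : ℕ}

/-- The probability of the graph `H` when distinct pairs `{i, j}` are joined independently with
probabilities `f (x i) (x j)`. -/
noncomputable def graphWeight (f : I → I → ℝ) (x : Fin n → I) (H : SimpleGraph (Fin n)) : ℝ :=
  open Classical in
  ∏ e : Fin n × Fin n with e.1 < e.2,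
    if H.Adj e.1 e.2 then f (x e.1) (x e.2) else 1 - f (x e.1) (x e.2)

/-- Conditional probability of a graph event `E` given that the latent positions are `x`. -/
noncomputable def condProb (f : I → I → ℝ) (x : Fin n → I) (E : Set (SimpleGraph (Fin n))) : ℝ :=
  open Classical in
  ∑ H : SimpleGraph (Fin n), if H ∈ E then graphWeight f x H else 0

/-- `(ξ, G)` is a sample of the graphon model: the latent positions are i.i.d. uniform on `[0,1]`
and, given `ξ`, the edges are independent Bernoulli variables with parameters `f (ξ i) (ξ j)`. -/
structure IsGraphonSample (f : I → I → ℝ) {Ω : Type*} [MeasurableSpace Ω] (μ : Measure Ω)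
    (ξ : Ω → Fin n → I) (G : Ω → SimpleGraph (Fin n)) : Prop where
  measurable_latent : Measurable ξ
  measurable_graph : ∀ H : SimpleGraph (Fin n), MeasurableSet (G ⁻¹' {H})
  latent_law : μ.map ξ = Measure.pi (fun _ : Fin n => (volume : Measure I))
  graph_law : ∀ (S : Set (Fin n → I)), MeasurableSet S → ∀ H : SimpleGraph (Fin n),
    μ (ξ ⁻¹' S ∩ G ⁻¹' {H}) =
      ∫⁻ x in S, ENNReal.ofReal (graphWeight f x H)
        ∂(Measure.pi (fun _ : Fin n => (volume : Measure I)))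

/-! ### The leave-one-out smoother -/

/-- The adjacency matrix `A`. -/
noncomputable def adj (H : SimpleGraph (Fin n)) (i j : Fin n) : ℝ :=
  open Classical in if H.Adj i j then 1 else 0

/-- The entry `(i, ℓ)`, for `i, ℓ ≠ j`, of the two-hop matrix `(A^{(-j)})² / (n - 1)` of the graph
with vertex `j` deleted. -/
noncomputable def twoHop (H : SimpleGraph (Fin n)) (j i ℓ : Fin n) : ℝ :=
  (∑ m ∈ Finset.univ.erase j, adj H i m * adj H m ℓ) / ((n : ℝ) - 1)

/-- The leave-one-out distance: the maximum over `ℓ ∉ {i, k, j}` of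
`|M^{(-j)}_{iℓ} - M^{(-j)}_{kℓ}|`. -/
noncomputable def dist (H : SimpleGraph (Fin n)) (j i k : Fin n) : ℝ :=
  ⨆ ℓ : {ℓ : Fin n // ℓ ≠ i ∧ ℓ ≠ k ∧ ℓ ≠ j}, |twoHop H j i ℓ - twoHop H j k ℓ|

/-- The leave-one-out neighbourhood: the first `h` elements of `V \ {i, j}` in increasing order of
the distance to `i`, ties being resolved by the smaller index. That is, `k` belongs to it when fewer
than `h` vertices of `V \ {i, j}` come strictly before `k`. -/
noncomputable def nbhd (H : SimpleGraph (Fin n)) (h : ℕ) (i j : Fin n) : Finset (Fin n) :=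
  open Classical in
  {k : Fin n | k ≠ i ∧ k ≠ j ∧
    Finset.card {k' : Fin n | k' ≠ i ∧ k' ≠ j ∧
      (dist H j i k' < dist H j i k ∨ (dist H j i k' = dist H j i k ∧ k' < k))} < h}

/-- The one-sided smoother: the average of `A_{kj}` over the neighbourhood. -/
noncomputable def smoother (H : SimpleGraph (Fin n)) (h : ℕ) (i j : Fin n) : ℝ :=
  (∑ k ∈ nbhd H h i j, adj H k j) / h

/-- The average of `P_{kj} = f (x k) (x j)` over the neighbourhood. -/
noncomputable def localAverage (f : I → I → ℝ) (x : Fin n → I) (H : SimpleGraph (Fin n)) (h : ℕ)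
    (i j : Fin n) : ℝ :=
  (∑ k ∈ nbhd H h i j, f (x k) (x j)) / h

/-- The sample variance of `A_{kj}` over the neighbourhood. -/
noncomputable def sampleVar (H : SimpleGraph (Fin n)) (h : ℕ) (i j : Fin n) : ℝ :=
  (∑ k ∈ nbhd H h i j, ∑ l ∈ nbhd H h i j with k < l, (adj H k j - adj H l j) ^ 2) /
    ((h : ℝ) * ((h : ℝ) - 1))

/-- The half-width of the empirical Bernstein interval. -/
noncomputable def halfWidth (H : SimpleGraph (Fin n)) (h : ℕ) (α : ℝ) (i j : Fin n) : ℝ :=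
  Real.sqrt (2 * sampleVar H h i j * Real.log (4 / α) / h) +
    7 * Real.log (4 / α) / (3 * ((h : ℝ) - 1))

/-- The empirical Bernstein interval. -/
noncomputable def bernsteinCI (H : SimpleGraph (Fin n)) (h : ℕ) (α : ℝ) (i j : Fin n) : Set ℝ :=
  Icc (smoother H h i j - halfWidth H h α i j) (smoother H h i j + halfWidth H h α i j) ∩ Icc 0 1

/-! ### Good edges and the two events -/

/-- `r_n = (log n / n)^{1/4}`. -/
noncomputable def rate (n : ℕ) : ℝ := (Real.log n / n) ^ (1 / 4 : ℝ)

/-- `(i, j) ∈ E_ε`. -/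
def GoodEdge {K : ℕ} (b : Fin (K + 1) → ℝ) (ε : ℝ) (x : Fin n → I) (i j : Fin n) : Prop :=
  i ≠ j ∧ (x i : ℝ) ∈ regularInterior b ε ∧ (x j : ℝ) ∈ regularInterior b ε

/-- The neighbourhood bias is at most `B` at all good edges. -/
def BiasBound {K : ℕ} (b : Fin (K + 1) → ℝ) (ε : ℝ) (f : I → I → ℝ) (h : ℕ) (B : ℝ)
    (x : Fin n → I) (H : SimpleGraph (Fin n)) : Prop :=
  ∀ i j : Fin n, GoodEdge b ε x i j → |f (x i) (x j) - localAverage f x H h i j| ≤ B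

/-- `P_{ij}` lies in the empirical Bernstein interval widened by `B` (a Minkowski sum). -/
def Covers (f : I → I → ℝ) (h : ℕ) (α B : ℝ) (i j : Fin n)
    (x : Fin n → I) (H : SimpleGraph (Fin n)) : Prop :=
  f (x i) (x j) ∈ bernsteinCI H h α i j + Icc (-B) B

end LOO

/-! Given the latent positions, a two-hop entry is, up to two terms, an average of products of edges
with disjoint supports. By Hoeffding it lies within O(r_n²), with r_n² = sqrt(log n / n), of the
kernel `hopMean`. Since h_n is of order n r_n², every position has more than h_n others of its own
block within O(r_n²) (`exists_latentRegular`). By the Lipschitz condition these are at two-hop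
distance O(r_n²) from it, hence so are all the selected neighbours (`dist_le_of_mem_nbhd`).

Conversely, a small two-hop distance forces close rows. The empirical squared distance of rows i and
k is a combination of four kernel entries in columns i and k (`sum_sq_sub_eq_hopMean`). The distance
omits these columns, but columns of nearby vertices replace them. A Hoeffding bound over the
positions passes to the L² distance: its square is O(r_n²). For large n, separation then excludes
different blocks, identifiability gives |ξ_i - ξ_k| = O(r_n), and the Lipschitz condition bounds the
bias (`biasBound_of_regular`). Taking this square root is what turns r_n² into r_n.

For coverage, the neighbourhood ignores the edges at j, so its entries A_kj remain independent with
means P_kj, and the smoother is within O(r_n) of the local average (`condProb_smoother_le`). Thus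
P_ij is within C r_n of the centre of the interval, and the widening alone gives coverage. These
bounds hold conditionally on a likely set of positions; `bias_and_coverage` integrates them.
Conditioning on a good edge costs a constant factor, as its probability is bounded below. For small
n, C is enlarged until C r_n ≥ 1. -/

/-! ### Independence and Hoeffding bounds on the Boolean cube. -/

section Cube

open ProbabilityTheory

variable {ι κ : Type*} [Fintype ι] [DecidableEq ι]
  {ν : ι → Measure Bool} [∀ e, IsProbabilityMeasure (ν e)]

/-- Under a product measure on the Boolean cube, functions of disjoint sets of coordinates are
independent. -/
theorem indepFun_of_dependsOn {β γ : Type*} [MeasurableSpace β] [MeasurableSpace γ]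
    {F : (ι → Bool) → β} {G : (ι → Bool) → γ} {S T : Finset ι} (hST : Disjoint S T)
    (hF : DependsOn F (S : Set ι)) (hG : DependsOn G (T : Set ι)) :
    IndepFun F G (Measure.pi ν) := by
  have h0 : iIndepFun (fun (i : ι) (w : ι → Bool) => w i) (Measure.pi ν) :=
    iIndepFun_pi (X := fun _ b => b) (fun i => aemeasurable_id)
  have h1 := h0.indepFun_finset S T hST (fun i => measurable_pi_apply i)
  -- The default `true` outside `U` is immaterial: `F` and `G` ignore those coordinates.
  let ext (U : Finset ι) (z : U → Bool) : ι → Bool := fun i => if hi : i ∈ U then z ⟨i, hi⟩ else true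
  have h2 := h1.comp (φ := fun z => F (ext S z)) (ψ := fun z => G (ext T z))
    (Measurable.of_discrete) (Measurable.of_discrete)
  convert h2 using 1
  · funext w
    exact hF (fun i hi => by simp [ext, Finset.mem_coe.1 hi])
  · funext w
    exact hG (fun i hi => by simp [ext, Finset.mem_coe.1 hi])

/-- Induction on `s`: head and tail read disjoint coordinates, hence are independent and their
variance proxies add. Hoeffding's lemma on an interval of length 1 gives the proxy 1/4 per summand.
-/
theorem hasSubgaussianMGF_sum_of_dependsOn {Y : κ → (ι → Bool) → ℝ} {S : κ → Finset ι}
    (s : Finset κ) (hY : ∀ m ∈ s, ∀ w, Y m w ∈ Icc (0 : ℝ) 1)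
    (hdep : ∀ m ∈ s, DependsOn (Y m) (S m : Set ι))
    (hdisj : (s : Set κ).PairwiseDisjoint S) :
    HasSubgaussianMGF (fun w => ∑ m ∈ s, (Y m w - ∫ w, Y m w ∂(Measure.pi ν)))
      (s.card * (1 / 4)) (Measure.pi ν) := by
  classical
  induction s using Finset.induction_on with
  | empty => simp
  | insert a s ha ih =>
    have h1 := ih (fun m hm => hY m (Finset.mem_insert_of_mem hm))
      (fun m hm => hdep m (Finset.mem_insert_of_mem hm))
      (hdisj.subset (by simp))
    have h2 : HasSubgaussianMGF (fun w => Y a w - ∫ w, Y a w ∂(Measure.pi ν)) (1 / 4)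
        (Measure.pi ν) := by
      have := hasSubgaussianMGF_of_mem_Icc (μ := Measure.pi ν) (X := Y a) (a := 0) (b := 1)
        Measurable.of_discrete.aemeasurable
        (Filter.Eventually.of_forall (hY a (Finset.mem_insert_self a s)))
      convert this using 1
      ext; norm_num
    have hi : IndepFun (fun w => Y a w - ∫ w, Y a w ∂(Measure.pi ν))
        (fun w => ∑ m ∈ s, (Y m w - ∫ w, Y m w ∂(Measure.pi ν))) (Measure.pi ν) := by
      refine indepFun_of_dependsOn (S := S a) (T := s.biUnion S) ?_ ?_ ?_
      · rw [Finset.disjoint_biUnion_right]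
        intro m hm
        exact hdisj (by simp) (by simp [hm]) (fun h => ha (h ▸ hm))
      · intro x y hxy
        simp only [hdep a (Finset.mem_insert_self a s) hxy]
      · intro x y hxy
        refine Finset.sum_congr rfl fun m hm => ?_
        rw [hdep m (Finset.mem_insert_of_mem hm) (fun i hi => hxy i ?_)]
        simp only [Finset.coe_biUnion, mem_iUnion]
        exact ⟨m, hm, hi⟩
    convert h2.add_of_indepFun h1 hi using 1
    · funext w
      rw [Finset.sum_insert ha]
    · rw [Finset.card_insert_of_notMem ha]
      push_cast
      ring

/-- A two-sided Hoeffding bound for sums of functions of disjoint blocks of coordinates. -/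
theorem measure_abs_sum_ge_le_of_dependsOn {Y : κ → (ι → Bool) → ℝ} {S : κ → Finset ι}
    (s : Finset κ) (hY : ∀ m ∈ s, ∀ w, Y m w ∈ Icc (0 : ℝ) 1)
    (hdep : ∀ m ∈ s, DependsOn (Y m) (S m : Set ι))
    (hdisj : (s : Set κ).PairwiseDisjoint S) {N t : ℝ} (hN : (s.card : ℝ) ≤ N)
    (ht : 0 ≤ t) :
    (Measure.pi ν).real {w | t < |∑ m ∈ s, (Y m w - ∫ w, Y m w ∂(Measure.pi ν))|} ≤
      2 * Real.exp (-2 * t ^ 2 / N) := by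
  have key := hasSubgaussianMGF_sum_of_dependsOn (ν := ν) s hY hdep hdisj
  -- With no summands the proxy vanishes and division by zero spoils the tail bound; the strict
  -- inequality makes the event empty instead.
  rcases s.eq_empty_or_nonempty with rfl | hs
  · have : {w : ι → Bool | t < |∑ m ∈ (∅ : Finset κ), (Y m w - ∫ w, Y m w ∂(Measure.pi ν))|} = ∅ := by
      ext w; simp [ht]
    rw [this]; simp; positivity
  have hc : (0 : ℝ) < s.card := by exact_mod_cast hs.card_pos
  have hexp : Real.exp (-t ^ 2 / (2 * ((s.card * (1 / 4) : NNReal) : ℝ))) ≤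
      Real.exp (-2 * t ^ 2 / N) := by
    rw [Real.exp_le_exp]
    push_cast
    have : -t ^ 2 / (2 * ((s.card : ℝ) * (1 / 4))) = -(2 * t ^ 2 / s.card) := by
      field_simp; ring
    rw [this, show -2 * t ^ 2 / N = -(2 * t ^ 2 / N) by ring]
    gcongr
  have h1 := (key.measure_ge_le ht).trans hexp
  have h2 := (key.neg.measure_ge_le ht).trans hexp
  rw [two_mul]
  refine (measureReal_mono ?_).trans ((measureReal_union_le _ _).trans (add_le_add h1 h2))
  intro w hw
  rcases lt_abs.1 (show t < |_| from hw) with h | h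
  · exact Or.inl h.le
  · exact Or.inr h.le

/-- If an event indexed by `s` has probability at most `q` and is independent of the selection `F`
for each value `s` of `F`, then the event selected by `F` has probability at most `q`. -/
theorem measure_selected_le {α : Type*} [Fintype α] {F : (ι → Bool) → α}
    {D : α → (ι → Bool) → Prop} {S T : Finset ι} (hST : Disjoint S T)
    (hF : DependsOn F (S : Set ι)) (hD : ∀ w, DependsOn (D (F w)) (T : Set ι)) {q : ℝ}
    (hq : ∀ w, (Measure.pi ν).real {w' | D (F w) w'} ≤ q) :
    (Measure.pi ν).real {w | D (F w) w} ≤ q := by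
  let mα : MeasurableSpace α := ⊤
  have hterm : ∀ s : α, (Measure.pi ν).real (F ⁻¹' {s} ∩ {w | D s w}) ≤
      (Measure.pi ν).real (F ⁻¹' {s}) * q := by
    intro s
    -- The hypotheses speak only of attained values of `F`; the other fibres are empty.
    by_cases hs : ∃ w, F w = s
    · obtain ⟨w₀, rfl⟩ := hs
      have h1 := (indepFun_of_dependsOn (ν := ν) hST hF (hD w₀)).measure_inter_preimage_eq_mul
        {F w₀} {p | p} trivial trivial
      have h2 : (Measure.pi ν).real (F ⁻¹' {F w₀} ∩ {w | D (F w₀) w}) =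
          (Measure.pi ν).real (F ⁻¹' {F w₀}) * (Measure.pi ν).real {w | D (F w₀) w} := by
        rw [measureReal_def, measureReal_def, measureReal_def, ← ENNReal.toReal_mul]
        exact congrArg ENNReal.toReal h1
      rw [h2]
      exact mul_le_mul_of_nonneg_left (hq w₀) measureReal_nonneg
    · have : F ⁻¹' {s} = ∅ := by
        ext w
        simpa using fun hw => hs ⟨w, hw⟩
      simp [this]
  calc _ ≤ (Measure.pi ν).real (⋃ s : α, F ⁻¹' {s} ∩ {w | D s w}) := by
        refine measureReal_mono fun w hw => ?_
        simp only [mem_iUnion]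
        exact ⟨F w, rfl, hw⟩
    _ ≤ ∑ s : α, (Measure.pi ν).real (F ⁻¹' {s} ∩ {w | D s w}) := measureReal_iUnion_fintype_le _
    _ ≤ ∑ s : α, (Measure.pi ν).real (F ⁻¹' {s}) * q := Finset.sum_le_sum fun s _ => hterm s
    _ = 1 * q := by
        rw [← Finset.sum_mul, sum_measureReal_preimage_singleton _
          (fun _ _ => MeasurableSet.of_discrete)]
        simp
    _ = q := one_mul _

end Cube

/-! ### Ranks and the leave-one-out neighbourhood. -/

/-- In a finite set ordered by an injective key, exactly `h` elements have rank below `h`. -/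
theorem Finset.card_filter_rank_lt {α β : Type*} [LinearOrder β] (g : α → β)
    (hg : Function.Injective g) (s : Finset α) {h : ℕ} (hs : h ≤ s.card) :
    (s.filter fun k => (s.filter fun k' => g k' < g k).card < h).card = h := by
  classical
  let rank : α → ℕ := fun k => (s.filter fun k' => g k' < g k).card
  have hlt : ∀ k ∈ s, ∀ k', g k < g k' → rank k < rank k' := by
    intro k hk k' hkk
    refine Finset.card_lt_card (Finset.ssubset_iff_of_subset ?_ |>.2 ⟨k, ?_, ?_⟩)
    · intro a ha
      simp only [Finset.mem_filter] at ha ⊢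
      exact ⟨ha.1, ha.2.trans hkk⟩
    · simp [hk, hkk]
    · simp
  have hinj : Set.InjOn rank (s : Set α) := by
    intro k hk k' hk' he
    by_contra hne
    rcases lt_or_gt_of_ne (hg.ne hne) with hl | hl
    · exact (hlt k hk k' hl).ne he
    · exact (hlt k' hk' k hl).ne he.symm
  -- An injection of `s` into `range s.card` is onto, so each rank occurs exactly once.
  have himg : s.image rank = Finset.range s.card := by
    refine Finset.eq_of_subset_of_card_le ?_ ?_
    · intro r hr
      obtain ⟨k, hk, rfl⟩ := Finset.mem_image.1 hr
      rw [Finset.mem_range]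
      exact Finset.card_lt_card (Finset.filter_ssubset.2 ⟨k, hk, lt_irrefl _⟩)
    · rw [Finset.card_image_of_injOn hinj, Finset.card_range]
  have h2 : (s.filter fun k => rank k < h).image rank = Finset.range h := by
    ext r
    simp only [Finset.mem_image, Finset.mem_filter, Finset.mem_range]
    constructor
    · rintro ⟨k, ⟨-, hk⟩, rfl⟩
      exact hk
    · intro hr
      have : r ∈ s.image rank := by
        rw [himg, Finset.mem_range]
        omega
      obtain ⟨k, hk, rfl⟩ := Finset.mem_image.1 this
      exact ⟨k, ⟨hk, hr⟩, rfl⟩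
  have h3 := Finset.card_image_of_injOn
    (hinj.mono (Finset.coe_subset.2 (Finset.filter_subset (fun k => rank k < h) s)))
  rw [h2, Finset.card_range] at h3
  exact h3.symm

namespace LOO

variable {n : ℕ}

theorem ne_of_mem_nbhd {H : SimpleGraph (Fin n)} {h : ℕ} {i j k : Fin n} (hk : k ∈ nbhd H h i j) :
    k ≠ i ∧ k ≠ j := by
  simp only [nbhd, Finset.mem_filter] at hk
  exact ⟨hk.2.1, hk.2.2.1⟩

theorem card_nbhd (H : SimpleGraph (Fin n)) {h : ℕ} {i j : Fin n} (hij : i ≠ j)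
    (hn : h ≤ n - 2) : (nbhd H h i j).card = h := by
  classical
  let s : Finset (Fin n) := Finset.univ.filter fun k => k ≠ i ∧ k ≠ j
  have hs : s.card = n - 2 := by
    have : s = Finset.univ \ {i, j} := by
      ext k; simp [s]
    rw [this, Finset.card_sdiff_of_subset (Finset.subset_univ _), Finset.card_pair hij]
    simp
  -- The lexicographic key encodes the tie-breaking rule; its second component makes it injective.
  have := Finset.card_filter_rank_lt (fun k => toLex (dist H j i k, k))
    (fun a b hab => (Prod.mk.inj (toLex.injective hab)).2) s (hs ▸ hn)
  refine Eq.trans ?_ this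
  congr 1
  ext k
  simp only [nbhd, s, Finset.mem_filter, Finset.mem_univ, true_and, Prod.Lex.toLex_lt_toLex,
    and_assoc, Finset.filter_filter]

/-- A distance bound shared by at least `h` vertices holds throughout the neighbourhood. -/
theorem dist_le_of_mem_nbhd {H : SimpleGraph (Fin n)} {h : ℕ} {i j k : Fin n} {D : ℝ}
    {s : Finset (Fin n)} (hs : h ≤ s.card)
    (hsD : ∀ k' ∈ s, k' ≠ i ∧ k' ≠ j ∧ dist H j i k' ≤ D) (hk : k ∈ nbhd H h i j) :
    dist H j i k ≤ D := by
  by_contra! hlt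
  simp only [nbhd, Finset.mem_filter, Finset.mem_univ, true_and] at hk
  -- If `k` were farther than `D`, all of `s` would precede it, giving it rank at least `h`.
  refine absurd hk.2.2 (not_lt.2 (hs.trans (Finset.card_le_card ?_)))
  intro k' hk'
  simp only [Finset.mem_filter, Finset.mem_univ, true_and]
  obtain ⟨h1, h2, h3⟩ := hsD k' hk'
  exact ⟨h1, h2, Or.inl (h3.trans_lt hlt)⟩

/-- The neighbourhood does not depend on the edges at the left-out vertex. -/
theorem nbhd_congr {H H' : SimpleGraph (Fin n)} {h : ℕ} {i j : Fin n} (hij : i ≠ j)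
    (hadj : ∀ a b, a ≠ j → b ≠ j → adj H a b = adj H' a b) : nbhd H h i j = nbhd H' h i j := by
  classical
  -- Row, column and intermediate index all avoid `j`, so no edge at `j` enters.
  have htwo : ∀ a b, a ≠ j → b ≠ j → twoHop H j a b = twoHop H' j a b := by
    intro a b ha hb
    unfold twoHop
    congr 1
    refine Finset.sum_congr rfl fun m hm => ?_
    rw [hadj a m ha (Finset.ne_of_mem_erase hm), hadj m b (Finset.ne_of_mem_erase hm) hb]
  have hd : ∀ k, k ≠ j → dist H j i k = dist H' j i k := by
    intro k hk
    unfold dist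
    congr 1
    funext l
    rw [htwo i l hij l.2.2.2, htwo k l hk l.2.2.2]
  ext k
  simp only [nbhd, Finset.mem_filter, Finset.mem_univ, true_and]
  refine and_congr_right fun _ => and_congr_right fun hk => ?_
  have : ∀ k', (k' ≠ i ∧ k' ≠ j ∧
      (dist H j i k' < dist H j i k ∨ (dist H j i k' = dist H j i k ∧ k' < k))) ↔
      (k' ≠ i ∧ k' ≠ j ∧
      (dist H' j i k' < dist H' j i k ∨ (dist H' j i k' = dist H' j i k ∧ k' < k))) := by
    intro k'
    refine and_congr_right fun _ => and_congr_right fun hk' => ?_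
    rw [hd k hk, hd k' hk']
  simp only [this]

theorem adj_congr {H H' : SimpleGraph (Fin n)} {a b c d : Fin n} (h : H.Adj a b ↔ H'.Adj c d) :
    adj H a b = adj H' c d := by
  unfold adj
  split_ifs <;> tauto

theorem adj_mem_Icc (H : SimpleGraph (Fin n)) (a b : Fin n) : adj H a b ∈ Icc (0 : ℝ) 1 := by
  unfold adj
  split_ifs <;> simp

/-! ### The edges as independent coordinates -/

/-- Pairs of vertices in increasing order. -/
abbrev Edge (n : ℕ) := {e : Fin n × Fin n // e.1 < e.2}

/-- The graph with a given set of edges. -/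
def graphOf (w : Edge n → Bool) : SimpleGraph (Fin n) where
  Adj a b := (∃ hab : a < b, w ⟨(a, b), hab⟩ = true) ∨ ∃ hba : b < a, w ⟨(b, a), hba⟩ = true
  symm := ⟨fun _ _ h => h.symm⟩
  loopless := ⟨fun a h => by simp at h⟩

open Classical in
/-- A graph on `Fin n` is the same as a set of increasing pairs. -/
noncomputable def graphEquiv (n : ℕ) : (Edge n → Bool) ≃ SimpleGraph (Fin n) where
  toFun := graphOf
  invFun H := fun e => decide (H.Adj e.1.1 e.1.2)
  left_inv w := by
    funext ⟨⟨a, b⟩, hab⟩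
    have hab' : a < b := hab
    simp [graphOf, hab', not_lt.2 hab'.le]
  right_inv H := by
    ext a b
    simp only [graphOf, decide_eq_true_eq, exists_prop]
    constructor
    · rintro (⟨-, h⟩ | ⟨-, h⟩)
      · exact h
      · exact h.symm
    · intro h
      rcases lt_or_gt_of_ne h.ne with hl | hl
      · exact Or.inl ⟨hl, h⟩
      · exact Or.inr ⟨hl, h.symm⟩

/-- The Bernoulli distribution on `Bool`. -/
noncomputable def coin (p : ℝ) : Measure Bool :=
  ENNReal.ofReal p • Measure.dirac true + ENNReal.ofReal (1 - p) • Measure.dirac false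

theorem isProbabilityMeasure_coin {p : ℝ} (hp : p ∈ Icc (0 : ℝ) 1) :
    IsProbabilityMeasure (coin p) := by
  constructor
  simp only [coin, Measure.add_apply, Measure.smul_apply, measure_univ, smul_eq_mul, mul_one]
  rw [← ENNReal.ofReal_add hp.1 (by linarith [hp.2])]
  simp

theorem coin_real_singleton {p : ℝ} (hp : p ∈ Icc (0 : ℝ) 1) (c : Bool) :
    (coin p).real {c} = if c = true then p else 1 - p := by
  cases c <;> simp [coin, measureReal_def, hp.1, hp.2]

/-- The joint law of the edges given the latent positions. -/
noncomputable def edgeLaw (f : I → I → ℝ) (x : Fin n → I) : Measure (Edge n → Bool) :=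
  Measure.pi fun e => coin (f (x e.1.1) (x e.1.2))

theorem isProbabilityMeasure_edgeLaw {f : I → I → ℝ} (hf : ∀ u v, f u v ∈ Icc (0 : ℝ) 1)
    (x : Fin n → I) : IsProbabilityMeasure (edgeLaw f x) := by
  have := fun e : Edge n => isProbabilityMeasure_coin (hf (x e.1.1) (x e.1.2))
  unfold edgeLaw
  infer_instance

/-- Turns the finite sum over graphs into a product-measure probability, where the independence
bounds apply: a graph weight is a product of coin masses. -/
theorem condProb_eq_measure {f : I → I → ℝ} (hf : ∀ u v, f u v ∈ Icc (0 : ℝ) 1) (x : Fin n → I)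
    (E : Set (SimpleGraph (Fin n))) :
    condProb f x E = (edgeLaw f x).real (graphOf ⁻¹' E) := by
  classical
  have := fun e : Edge n => isProbabilityMeasure_coin (hf (x e.1.1) (x e.1.2))
  have := isProbabilityMeasure_edgeLaw hf x
  have hw : ∀ w : Edge n → Bool, (edgeLaw f x).real {w} = graphWeight f x (graphOf w) := by
    intro w
    rw [edgeLaw, ← univ_pi_singleton, measureReal_def, Measure.pi_pi, ENNReal.toReal_prod]
    unfold graphWeight
    rw [Finset.prod_subtype (p := fun e : Fin n × Fin n => e.1 < e.2) _ (by simp)]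
    refine Finset.prod_congr rfl fun e _ => ?_
    rw [← measureReal_def, coin_real_singleton (hf _ _)]
    obtain ⟨⟨a, b⟩, hab⟩ := e
    have hab' : a < b := hab
    have : (graphOf w).Adj a b ↔ w ⟨(a, b), hab⟩ = true := by
      simp [graphOf, hab', not_lt.2 hab'.le]
    simp only [this]
  have hsum : (edgeLaw f x).real (graphOf ⁻¹' E) =
      ∑ w ∈ Finset.univ.filter (fun w => graphOf w ∈ E), (edgeLaw f x).real {w} := by
    rw [sum_measureReal_singleton]
    congr 1
    ext w
    simp
  rw [hsum, Finset.sum_filter]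
  unfold condProb
  rw [← (graphEquiv n).sum_comp]
  refine Finset.sum_congr rfl fun w _ => ?_
  have : (graphEquiv n) w = graphOf w := rfl
  rw [this, hw]

theorem condProb_mono {f : I → I → ℝ} (hf : ∀ u v, f u v ∈ Icc (0 : ℝ) 1) (x : Fin n → I)
    {E F : Set (SimpleGraph (Fin n))} (h : E ⊆ F) : condProb f x E ≤ condProb f x F := by
  have := isProbabilityMeasure_edgeLaw hf x
  rw [condProb_eq_measure hf, condProb_eq_measure hf]
  exact measureReal_mono (preimage_mono h)

theorem condProb_compl {f : I → I → ℝ} (hf : ∀ u v, f u v ∈ Icc (0 : ℝ) 1) (x : Fin n → I)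
    (E : Set (SimpleGraph (Fin n))) : condProb f x Eᶜ = 1 - condProb f x E := by
  have := isProbabilityMeasure_edgeLaw hf x
  rw [condProb_eq_measure hf, condProb_eq_measure hf, preimage_compl,
    probReal_compl_eq_one_sub MeasurableSet.of_discrete]

theorem condProb_union_le {f : I → I → ℝ} (hf : ∀ u v, f u v ∈ Icc (0 : ℝ) 1) (x : Fin n → I)
    (E F : Set (SimpleGraph (Fin n))) :
    condProb f x (E ∪ F) ≤ condProb f x E + condProb f x F := by
  have := isProbabilityMeasure_edgeLaw hf x
  rw [condProb_eq_measure hf, condProb_eq_measure hf, condProb_eq_measure hf, preimage_union]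
  exact measureReal_union_le _ _

theorem condProb_iUnion_le {f : I → I → ℝ} (hf : ∀ u v, f u v ∈ Icc (0 : ℝ) 1) (x : Fin n → I)
    {ι : Type*} [Fintype ι] (E : ι → Set (SimpleGraph (Fin n))) :
    condProb f x (⋃ a, E a) ≤ ∑ a, condProb f x (E a) := by
  have := isProbabilityMeasure_edgeLaw hf x
  simp only [condProb_eq_measure hf, preimage_iUnion]
  exact measureReal_iUnion_fintype_le _

/-- The increasing pairs joining two given vertices (at most one). -/
def edgesBetween (a b : Fin n) : Finset (Edge n) :=
  Finset.univ.filter fun e => (e.1.1 = a ∧ e.1.2 = b) ∨ (e.1.1 = b ∧ e.1.2 = a)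

theorem dependsOn_adj (a b : Fin n) :
    DependsOn (fun w : Edge n → Bool => adj (graphOf w) a b) (edgesBetween a b : Set (Edge n)) := by
  intro w w' hw
  have h1 : ∀ h : a < b, w ⟨(a, b), h⟩ = w' ⟨(a, b), h⟩ := fun h => hw _ (by simp [edgesBetween])
  have h2 : ∀ h : b < a, w ⟨(b, a), h⟩ = w' ⟨(b, a), h⟩ := fun h => hw _ (by simp [edgesBetween])
  refine adj_congr ?_
  simp only [graphOf, h1, h2]

theorem disjoint_edgesBetween {a b c d : Fin n} (h1 : ¬(a = c ∧ b = d)) (h2 : ¬(a = d ∧ b = c)) :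
    Disjoint (edgesBetween a b) (edgesBetween c d) := by
  rw [Finset.disjoint_left]
  intro e he he'
  simp only [edgesBetween, Finset.mem_filter, Finset.mem_univ, true_and] at he he'
  grind

theorem integral_adj {f : I → I → ℝ} (hf : ∀ u v, f u v ∈ Icc (0 : ℝ) 1)
    (hsymm : ∀ u v, f u v = f v u) (x : Fin n → I) {a b : Fin n} (hab : a ≠ b) :
    ∫ w, adj (graphOf w) a b ∂(edgeLaw f x) = f (x a) (x b) := by
  wlog hlt : a < b generalizing a b
  · rw [hsymm, ← this hab.symm (lt_of_le_of_ne (not_lt.1 hlt) hab.symm)]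
    congr 1
    funext w
    exact adj_congr ((graphOf w).adj_comm a b)
  have := fun e : Edge n => isProbabilityMeasure_coin (hf (x e.1.1) (x e.1.2))
  let e : Edge n := ⟨(a, b), hlt⟩
  have h1 : ∀ w : Edge n → Bool, adj (graphOf w) a b = (fun c : Bool => if c then (1 : ℝ) else 0) (w e) := by
    intro w
    simp [adj, graphOf, hlt, not_lt.2 hlt.le, e]
  rw [integral_congr_ae (Filter.Eventually.of_forall h1), edgeLaw,
    integral_comp_eval (μ := fun e : Edge n => coin (f (x e.1.1) (x e.1.2))) (i := e)
      (f := fun c : Bool => if c then (1 : ℝ) else 0)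
      Measurable.of_discrete.aestronglyMeasurable]
  rw [integral_fintype (Integrable.of_finite)]
  simp [coin_real_singleton (hf _ _), e]

/-! ### Concentration of the graph given the latent positions. -/

/-- Concentration of the number of two-step paths given the latent positions. -/
theorem condProb_twoStep_le {f : I → I → ℝ} (hf : ∀ u v, f u v ∈ Icc (0 : ℝ) 1)
    (hsymm : ∀ u v, f u v = f v u) (x : Fin n → I) (j : Fin n) {i l : Fin n} (hil : i ≠ l)
    {t : ℝ} (ht : 0 ≤ t) :
    condProb f x {H | t + 2 < |∑ m ∈ Finset.univ.erase j,
      (adj H i m * adj H m l - f (x i) (x m) * f (x m) (x l))|} ≤ 2 * Real.exp (-2 * t ^ 2 / n) := by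
  classical
  have := fun e : Edge n => isProbabilityMeasure_coin (hf (x e.1.1) (x e.1.2))
  have := isProbabilityMeasure_edgeLaw hf x
  -- For `m = i` or `m = l` one factor is a diagonal entry, so the mean is not the product of the
  -- `f` values. These at most two terms are bounded by 1 each, which accounts for the `+ 2` in the
  -- threshold.
  let s := (Finset.univ.erase j).filter fun m : Fin n => m ≠ i ∧ m ≠ l
  let Y : Fin n → (Edge n → Bool) → ℝ := fun m w => adj (graphOf w) i m * adj (graphOf w) m l
  have hmul : ∀ {a b : ℝ}, a ∈ Icc (0 : ℝ) 1 → b ∈ Icc (0 : ℝ) 1 → a * b ∈ Icc (0 : ℝ) 1 :=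
    fun ha hb => ⟨mul_nonneg ha.1 hb.1, mul_le_one₀ ha.2 hb.1 hb.2⟩
  have hE : ∀ m ∈ s, ∫ w, Y m w ∂(edgeLaw f x) = f (x i) (x m) * f (x m) (x l) := by
    intro m hm
    simp only [s, Finset.mem_filter] at hm
    -- As `i ≠ l`, the two factors are different edges.
    have hind : ProbabilityTheory.IndepFun (fun w => adj (graphOf w) i m)
        (fun w => adj (graphOf w) m l) (edgeLaw f x) :=
      indepFun_of_dependsOn (disjoint_edgesBetween (by grind) (by grind))
        (dependsOn_adj i m) (dependsOn_adj m l)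
    have := hind.integral_mul_eq_mul_integral Measurable.of_discrete.aestronglyMeasurable
      Measurable.of_discrete.aestronglyMeasurable
    rw [integral_adj hf hsymm x hm.2.1.symm, integral_adj hf hsymm x hm.2.2] at this
    exact this
  have key := measure_abs_sum_ge_le_of_dependsOn
    (ν := fun e : Edge n => coin (f (x e.1.1) (x e.1.2))) (Y := Y)
    (S := fun m => edgesBetween i m ∪ edgesBetween m l) s (N := n) (t := t)
    (fun m _ w => hmul (adj_mem_Icc _ _ _) (adj_mem_Icc _ _ _))
    (fun m _ w w' hw => by
      have h1 := dependsOn_adj i m (x := w) (y := w') (fun e he => hw e (by simp [Finset.mem_coe.1 he]))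
      have h2 := dependsOn_adj m l (x := w) (y := w') (fun e he => hw e (by simp [Finset.mem_coe.1 he]))
      simp only [] at h1 h2
      simp only [Y, h1, h2])
    (by
      intro m hm m' hm' hne
      simp only [s, Finset.coe_filter, mem_ofPred_eq, Finset.mem_erase, Finset.mem_univ] at hm hm'
      simp only [Function.onFun, Finset.disjoint_union_left, Finset.disjoint_union_right]
      refine ⟨⟨?_, ?_⟩, ?_, ?_⟩ <;> refine disjoint_edgesBetween ?_ ?_ <;> grind)
    (by exact_mod_cast (Finset.card_le_univ s).trans_eq (Fintype.card_fin n)) ht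
  rw [condProb_eq_measure hf]
  refine le_trans (measureReal_mono ?_) key
  intro w hw
  simp only [mem_preimage, mem_ofPred_eq] at hw ⊢
  rw [← Finset.sum_filter_add_sum_filter_not _ (fun m : Fin n => m ≠ i ∧ m ≠ l)] at hw
  have hA : ∑ m ∈ s, (Y m w - ∫ w, Y m w ∂(edgeLaw f x)) =
      ∑ m ∈ s, (adj (graphOf w) i m * adj (graphOf w) m l - f (x i) (x m) * f (x m) (x l)) :=
    Finset.sum_congr rfl fun m hm => by rw [hE m hm]
  have hB : |∑ m ∈ (Finset.univ.erase j).filter (fun m : Fin n => ¬(m ≠ i ∧ m ≠ l)),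
      (adj (graphOf w) i m * adj (graphOf w) m l - f (x i) (x m) * f (x m) (x l))| ≤ 2 := by
    refine (Finset.abs_sum_le_sum_abs _ _).trans ?_
    refine (Finset.sum_le_card_nsmul _ _ 1 fun m _ => ?_).trans ?_
    · obtain ⟨h1, h2⟩ := hmul (adj_mem_Icc (graphOf w) i m) (adj_mem_Icc (graphOf w) m l)
      obtain ⟨h3, h4⟩ := hmul (hf (x i) (x m)) (hf (x m) (x l))
      rw [abs_le]
      constructor <;> linarith
    · have : ((Finset.univ.erase j).filter (fun m : Fin n => ¬(m ≠ i ∧ m ≠ l))).card ≤ 2 := by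
        refine (Finset.card_le_card (t := {i, l}) ?_).trans Finset.card_le_two
        intro m hm
        simp only [Finset.mem_filter] at hm
        grind
      simp only [nsmul_eq_mul, mul_one]
      exact_mod_cast this
  change t < |∑ m ∈ s, (Y m w - ∫ w, Y m w ∂(edgeLaw f x))|
  rw [hA]
  have := hw.trans_le (abs_add_le _ _)
  simp only [s]
  linarith

/-- Concentration of the smoother around the local average: the neighbourhood is independent of the
edges at the left-out vertex. -/
theorem condProb_smoother_le {f : I → I → ℝ} (hf : ∀ u v, f u v ∈ Icc (0 : ℝ) 1)
    (hsymm : ∀ u v, f u v = f v u) (x : Fin n → I) {i j : Fin n} (hij : i ≠ j) {h : ℕ}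
    (hn : h ≤ n - 2) {t : ℝ} (ht : 0 ≤ t) :
    condProb f x {H | t < |∑ k ∈ nbhd H h i j, (adj H k j - f (x k) (x j))|} ≤
      2 * Real.exp (-2 * t ^ 2 / h) := by
  classical
  have := fun e : Edge n => isProbabilityMeasure_coin (hf (x e.1.1) (x e.1.2))
  have := isProbabilityMeasure_edgeLaw hf x
  let T : Finset (Edge n) := Finset.univ.filter fun e => e.1.1 ≠ j ∧ e.1.2 ≠ j
  have hN : DependsOn (fun w => nbhd (graphOf w) h i j) (T : Set (Edge n)) := by
    intro w w' hw
    refine nbhd_congr hij fun a b ha hb => dependsOn_adj a b fun e he => hw e ?_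
    simp only [edgesBetween, Finset.coe_filter, Finset.mem_univ, true_and, mem_ofPred_eq] at he
    simp only [T, Finset.coe_filter, Finset.mem_univ, true_and, mem_ofPred_eq]
    grind
  rw [condProb_eq_measure hf]
  -- The set is selected by edges avoiding `j` and tested on edges at `j`, so it may be treated as a
  -- fixed set of `h` vertices.
  refine measure_selected_le (F := fun w => nbhd (graphOf w) h i j)
    (D := fun s w => t < |∑ k ∈ s, (adj (graphOf w) k j - f (x k) (x j))|)
    (S := T) (T := Tᶜ) disjoint_compl_right hN ?_ ?_
  · intro w₀ w w' hw
    have : ∀ k ∈ nbhd (graphOf w₀) h i j, adj (graphOf w) k j = adj (graphOf w') k j :=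
      fun k hk => dependsOn_adj k j fun e he => hw e (by
        simp only [edgesBetween, Finset.coe_filter, Finset.mem_univ, true_and, mem_ofPred_eq] at he
        simp only [T, Finset.mem_coe, Finset.mem_compl, Finset.mem_filter, Finset.mem_univ,
          true_and]
        grind)
    simp only []
    rw [Finset.sum_congr rfl fun k hk => by rw [this k hk]]
  · intro w₀
    have hsj : ∀ k ∈ nbhd (graphOf w₀) h i j, k ≠ j := fun k hk => (ne_of_mem_nbhd hk).2
    have key := measure_abs_sum_ge_le_of_dependsOn
      (ν := fun e : Edge n => coin (f (x e.1.1) (x e.1.2)))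
      (Y := fun k w => adj (graphOf w) k j)
      (S := fun k => edgesBetween k j) (nbhd (graphOf w₀) h i j) (N := h) (t := t)
      (fun m _ w => adj_mem_Icc _ _ _)
      (fun m _ => dependsOn_adj m j)
      (by
        intro m hm m' hm' hne
        have := hsj m hm
        have := hsj m' hm'
        exact disjoint_edgesBetween (by grind) (by grind))
      (by rw [card_nbhd _ hij hn]) ht
    refine le_trans (le_of_eq ?_) key
    congr 1
    ext w
    have : ∑ k ∈ nbhd (graphOf w₀) h i j, (adj (graphOf w) k j - f (x k) (x j)) =
        ∑ k ∈ nbhd (graphOf w₀) h i j,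
          (adj (graphOf w) k j - ∫ w, adj (graphOf w) k j ∂(edgeLaw f x)) :=
      Finset.sum_congr rfl fun k hk => by rw [integral_adj hf hsymm x (hsj k hk)]
    simp only [mem_ofPred_eq, this]
    rfl

/-! ### Concentration of the latent positions. -/

/-- The law of the latent positions. -/
noncomputable abbrev latentLaw (n : ℕ) : Measure (Fin n → I) :=
  Measure.pi fun _ : Fin n => (volume : Measure I)

/-- One direction suffices: windows must not contain too few points, and L² distances must not
exceed their empirical versions by much. -/
theorem measure_pi_sum_ge_le {J : Type*} [Fintype J] {g : I → ℝ} (hg : Measurable g)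
    (hg01 : ∀ y, g y ∈ Icc (0 : ℝ) 1) {N t : ℝ} (hN : (Fintype.card J : ℝ) ≤ N) (ht : 0 ≤ t) :
    (Measure.pi fun _ : J => (volume : Measure I)).real
      {x | t < ∑ m, ((∫ y, g y) - g (x m))} ≤ Real.exp (-2 * t ^ 2 / N) := by
  have hind : ProbabilityTheory.iIndepFun (fun (m : J) (x : J → I) => (∫ y, g y) - g (x m))
      (Measure.pi fun _ : J => (volume : Measure I)) :=
    ProbabilityTheory.iIndepFun_pi (X := fun _ y => (∫ y, g y) - g y)
      (fun _ => (measurable_const.sub hg).aemeasurable)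
  have hsub : ∀ m : J, ProbabilityTheory.HasSubgaussianMGF
      (fun x : J → I => (∫ y, g y) - g (x m)) (1 / 4)
      (Measure.pi fun _ : J => (volume : Measure I)) := by
    intro m
    have h1 := ProbabilityTheory.hasSubgaussianMGF_of_mem_Icc
      (μ := Measure.pi fun _ : J => (volume : Measure I))
      (X := fun x : J → I => g (x m)) (a := 0) (b := 1)
      (hg.comp (measurable_pi_apply m)).aemeasurable (Filter.Eventually.of_forall fun x => hg01 _)
    rw [integral_comp_eval (μ := fun _ : J => (volume : Measure I)) (i := m)
      hg.aestronglyMeasurable] at h1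
    have h2 := h1.neg
    convert h2 using 1
    · funext x
      simp
    · ext; norm_num
  have key := ProbabilityTheory.HasSubgaussianMGF.measure_sum_ge_le_of_iIndepFun hind
    (c := fun _ => 1 / 4) (s := Finset.univ) (fun m _ => hsub m) ht
  rcases isEmpty_or_nonempty J with hJ | hJ
  · have : {x : J → I | t < ∑ m, ((∫ y, g y) - g (x m))} = ∅ := by
      ext x
      simpa using ht
    rw [this, measureReal_empty]
    positivity
  have hle : {x : J → I | t < ∑ m, ((∫ y, g y) - g (x m))} ⊆
      {x | t ≤ ∑ m, ((∫ y, g y) - g (x m))} := fun x hx => le_of_lt (mem_ofPred_eq ▸ hx)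
  refine (measureReal_mono hle).trans (key.trans ?_)
  have hc : (0 : ℝ) < Fintype.card J := by exact_mod_cast Fintype.card_pos
  rw [Real.exp_le_exp]
  have : -t ^ 2 / (2 * ((∑ i : J, (1 / 4 : NNReal) : NNReal) : ℝ)) =
      -(2 * t ^ 2 / Fintype.card J) := by
    simp only [Finset.sum_const, Finset.card_univ, nsmul_eq_mul]
    push_cast
    field_simp
    ring
  push_cast at this ⊢
  rw [this, show -2 * t ^ 2 / N = -(2 * t ^ 2 / N) by ring]
  gcongr

theorem measurable_integral_latent {g : I → I → I → ℝ}
    (hg : Measurable fun p : (I × I) × I => g p.1.1 p.1.2 p.2) (i k : Fin n) :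
    Measurable fun x : Fin n → I => ∫ y, g (x i) (x k) y := by
  have h1 : Measurable fun p : I × I => ∫ y, g p.1 p.2 y :=
    (hg.stronglyMeasurable.integral_prod_right').measurable
  have h2 : Measurable fun x : Fin n → I => (x i, x k) := by fun_prop
  exact h1.comp h2

theorem measurableSet_latent_sum {g : I → I → I → ℝ}
    (hg : Measurable fun p : (I × I) × I => g p.1.1 p.1.2 p.2) (i k : Fin n) (t : ℝ) :
    MeasurableSet {x : Fin n → I | t < ∑ m with ¬(m = i ∨ m = k),
      ((∫ y, g (x i) (x k) y) - g (x i) (x k) (x m))} := by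
  refine measurableSet_lt measurable_const (Finset.measurable_sum _ fun m _ => ?_)
  refine (measurable_integral_latent hg i k).sub ?_
  have h2 : Measurable fun x : Fin n → I => ((x i, x k), x m) := by fun_prop
  exact hg.comp h2

/-- Hoeffding's inequality for sums over the latent positions, with a summand that may depend on
two of the positions. -/
theorem latentLaw_sum_ge_le {g : I → I → I → ℝ}
    (hg : Measurable fun p : (I × I) × I => g p.1.1 p.1.2 p.2)
    (hg01 : ∀ u v y, g u v y ∈ Icc (0 : ℝ) 1) (i k : Fin n) {t : ℝ} (ht : 0 ≤ t) :
    latentLaw n {x | t < ∑ m with ¬(m = i ∨ m = k),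
      ((∫ y, g (x i) (x k) y) - g (x i) (x k) (x m))} ≤
      ENNReal.ofReal (Real.exp (-2 * t ^ 2 / n)) := by
  classical
  set A := {x : Fin n → I | t < ∑ m with ¬(m = i ∨ m = k),
      ((∫ y, g (x i) (x k) y) - g (x i) (x k) (x m))} with hA
  have hAm : MeasurableSet A := measurableSet_latent_sum hg i k t
  -- Fubini: with positions `i` and `k` frozen, the summand is a fixed function of each remaining
  -- position.
  let p : Fin n → Prop := fun m => m = i ∨ m = k
  have hmp := measurePreserving_piEquivPiSubtypeProd (fun _ : Fin n => (volume : Measure I)) p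
  let e := MeasurableEquiv.piEquivPiSubtypeProd (fun _ : Fin n => I) p
  have hmp' : MeasurePreserving e.symm _ (latentLaw n) := hmp.symm e
  rw [← hmp'.measure_preimage hAm.nullMeasurableSet,
    Measure.prod_apply (e.symm.measurable hAm)]
  refine (lintegral_mono (g := fun _ => ENNReal.ofReal (Real.exp (-2 * t ^ 2 / n)))
    fun a => ?_).trans (by simp)
  have hN : (Fintype.card {m : Fin n // ¬p m} : ℝ) ≤ n := by
    exact_mod_cast (Fintype.card_subtype_le _).trans_eq (Fintype.card_fin n)
  have hga : Measurable (g (a ⟨i, Or.inl rfl⟩) (a ⟨k, Or.inr rfl⟩)) := by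
    have h2 : Measurable fun y : I => ((a ⟨i, Or.inl rfl⟩, a ⟨k, Or.inr rfl⟩), y) := by fun_prop
    exact hg.comp h2
  have h1 := measure_pi_sum_ge_le (J := {m : Fin n // ¬p m})
    (g := g (a ⟨i, Or.inl rfl⟩) (a ⟨k, Or.inr rfl⟩))
    hga (hg01 _ _) hN ht
  rw [← ENNReal.ofReal_toReal (measure_ne_top _ _)]
  refine ENNReal.ofReal_le_ofReal (le_trans (le_of_eq ?_) h1)
  rw [measureReal_def]
  congr 2
  ext y
  have hi : e.symm (a, y) i = a ⟨i, Or.inl rfl⟩ := by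
    simp [e, MeasurableEquiv.piEquivPiSubtypeProd, Equiv.piEquivPiSubtypeProd, p]
  have hk : e.symm (a, y) k = a ⟨k, Or.inr rfl⟩ := by
    simp [e, MeasurableEquiv.piEquivPiSubtypeProd, Equiv.piEquivPiSubtypeProd, p]
  have hm : ∀ m : {m : Fin n // ¬p m}, e.symm (a, y) m = y m := by
    intro m
    have := m.2
    simp [e, MeasurableEquiv.piEquivPiSubtypeProd, Equiv.piEquivPiSubtypeProd, this]
  simp only [mem_preimage, hA, mem_ofPred_eq, hi, hk]
  rw [Finset.sum_subtype (p := fun m => ¬p m)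
    (F := inferInstanceAs (Fintype {m : Fin n // ¬p m})) _ (by simp [p])]
  simp only [hm]

/-! ### Positions and blocks -/

theorem exists_mem_block {K : ℕ} {b : Fin (K + 1) → ℝ} (hb : IsPartition b) {u : ℝ}
    (hu : u ∈ Icc (0 : ℝ) 1) (hne : ∀ m, u ≠ b m) : ∃ m, u ∈ block b m := by
  classical
  obtain ⟨k, hk, hmax⟩ := Finset.exists_max_image
    (Finset.univ.filter fun k : Fin (K + 1) => b k ≤ u) id ⟨0, by simp [hb.first, hu.1]⟩
  simp only [Finset.mem_filter, Finset.mem_univ, true_and, id] at hk hmax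
  have hlast : k ≠ Fin.last K := by
    rintro rfl
    rw [hb.last] at hk
    exact hne (Fin.last K) (by rw [hb.last]; exact le_antisymm hu.2 hk)
  obtain ⟨m, rfl⟩ := Fin.exists_castSucc_eq.2 hlast
  refine ⟨m, lt_of_le_of_ne hk (hne _).symm, ?_⟩
  by_contra! hle
  exact absurd (hmax _ hle) (not_le.2 (Fin.castSucc_lt_succ))

theorem block_subset {K : ℕ} {b : Fin (K + 1) → ℝ} (hb : IsPartition b) (m : Fin K) :
    block b m ⊆ Ioo 0 1 := by
  intro u hu
  have h0 := hb.strictMono.monotone (Fin.zero_le m.castSucc)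
  have h1 := hb.strictMono.monotone (Fin.le_last m.succ)
  rw [hb.first] at h0
  rw [hb.last] at h1
  exact ⟨h0.trans_lt hu.1, hu.2.trans_le h1⟩

theorem blockInterior_subset {K : ℕ} {b : Fin (K + 1) → ℝ} {ε : ℝ} (hε : 0 < ε) (m : Fin K) :
    blockInterior b ε m ⊆ block b m := fun _ hu => ⟨by linarith [hu.1], by linarith [hu.2]⟩

/-- The breakpoints form a finite, hence null, set. -/
theorem ae_mem_block {K : ℕ} {b : Fin (K + 1) → ℝ} (hb : IsPartition b) :
    ∃ X : Set (Fin n → I), MeasurableSet X ∧ latentLaw n Xᶜ = 0 ∧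
      ∀ x ∈ X, ∀ i, ∃ m, (x i : ℝ) ∈ block b m := by
  let N : Set I := {y | ∃ m, (y : ℝ) = b m}
  have hN : N.Finite := by
    have : N = Subtype.val ⁻¹' (range b) := by
      ext y
      simp [N, eq_comm]
    rw [this]
    exact (finite_range b).preimage Subtype.val_injective.injOn
  refine ⟨⋂ i, (fun x => x i) ⁻¹' Nᶜ, ?_, ?_, ?_⟩
  · exact MeasurableSet.iInter fun i => measurable_pi_apply i hN.measurableSet.compl
  · rw [compl_iInter, measure_iUnion_null_iff]
    intro i
    rw [← preimage_compl, compl_compl]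
    have := (measurePreserving_eval (fun _ : Fin n => (volume : Measure I)) i).measure_preimage
      hN.measurableSet.nullMeasurableSet
    exact this.trans (hN.countable.measure_zero _)
  · intro x hx i
    refine exists_mem_block hb (x i).2 fun m hm => ?_
    exact (mem_iInter.1 hx i) ⟨m, hm⟩

/-- The latent configurations for which the neighbourhood construction works. -/
structure LatentRegular {K : ℕ} (b : Fin (K + 1) → ℝ) (f : I → I → ℝ) (N : ℕ) (t s : ℝ)
    (x : Fin n → I) : Prop where
  mem_block : ∀ i, ∃ m, (x i : ℝ) ∈ block b m
  window : ∀ i m, (x i : ℝ) ∈ block b m →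
    ∃ W : Finset (Fin n), N ≤ W.card ∧
      ∀ k ∈ W, k ≠ i ∧ (x k : ℝ) ∈ block b m ∧ |(x k : ℝ) - x i| ≤ t
  rows : ∀ i k, ∫ y, (f (x i) y - f (x k) y) ^ 2 ≤
    (∑ m, (f (x i) (x m) - f (x k) (x m)) ^ 2) / n + s

theorem integral_indicator_Icc {u v : ℝ} (hu : 0 ≤ u) (huv : u ≤ v) (hv : v ≤ 1) :
    ∫ y : I, (if u ≤ (y : ℝ) ∧ (y : ℝ) ≤ v then (1 : ℝ) else 0) = v - u := by
  have : (fun y : I => if u ≤ (y : ℝ) ∧ (y : ℝ) ≤ v then (1 : ℝ) else 0) =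
      (Icc (⟨u, hu, huv.trans hv⟩ : I) ⟨v, hu.trans huv, hv⟩).indicator 1 := by
    funext y
    simp [indicator, ← Subtype.coe_le_coe]
  rw [this, integral_indicator_one measurableSet_Icc, measureReal_def, unitInterval.volume_Icc,
    ENNReal.toReal_ofReal (by simpa using huv)]

/-- There are `n - 1` trials, each with success probability `hi - lo`. The repeated `m = i` comes
from using the two-index Hoeffding bound with equal indices. -/
theorem card_window_ge {x : Fin n → I} {i : Fin n} {lo hi : ℝ} (h0 : 0 ≤ lo) (h1 : lo ≤ hi)
    (h2 : hi ≤ 1) {τ : ℝ}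
    (hx : ∑ m with ¬(m = i ∨ m = i),
      ((∫ y : I, if lo ≤ (y : ℝ) ∧ (y : ℝ) ≤ hi then (1 : ℝ) else 0) -
        if lo ≤ (x m : ℝ) ∧ (x m : ℝ) ≤ hi then (1 : ℝ) else 0) ≤ τ) :
    ((n : ℝ) - 1) * (hi - lo) - τ ≤
      (Finset.univ.filter fun m : Fin n => m ≠ i ∧ lo ≤ (x m : ℝ) ∧ (x m : ℝ) ≤ hi).card := by
  classical
  rw [integral_indicator_Icc h0 h1 h2, Finset.sum_sub_distrib, Finset.sum_const,
    Finset.sum_boole, Finset.filter_filter] at hx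
  have hc : (Finset.univ.filter fun m : Fin n => ¬(m = i ∨ m = i)).card = n - 1 := by
    have : (Finset.univ.filter fun m : Fin n => ¬(m = i ∨ m = i)) = Finset.univ.erase i := by
      ext m; simp
    rw [this, Finset.card_erase_of_mem (Finset.mem_univ i)]
    simp
  have hn : 1 ≤ n := Nat.one_le_of_lt i.2
  rw [hc, nsmul_eq_mul, Nat.cast_sub hn] at hx
  simp only [or_self] at hx
  push_cast at hx
  linarith

/-- A union bound over `2 * n` window events and `n ^ 2` row events, outside the null set of
positions at breakpoints. -/
theorem exists_latentRegular {K : ℕ} {b : Fin (K + 1) → ℝ} (hb : IsPartition b) {f : I → I → ℝ}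
    (hfm : Measurable (Function.uncurry f)) (hf : ∀ u v, f u v ∈ Icc (0 : ℝ) 1)
    {N : ℕ} {t s τ : ℝ} (hn : 0 < n) (ht : 0 ≤ t) (htb : ∀ m : Fin K, 2 * t < b m.succ - b m.castSucc)
    (hτ : 0 ≤ τ) (hN : (N : ℝ) ≤ ((n : ℝ) - 1) * t - τ) (hs : (τ + 2) / n ≤ s) :
    ∃ X : Set (Fin n → I), MeasurableSet X ∧ (∀ x ∈ X, LatentRegular b f N t s x) ∧
      latentLaw n Xᶜ ≤ ENNReal.ofReal (((n : ℝ) ^ 2 + 2 * n) * Real.exp (-2 * τ ^ 2 / n)) := by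
  classical
  obtain ⟨X₀, hX₀m, hX₀, hX₀b⟩ := ae_mem_block (n := n) hb
  -- Windows to the right and to the left of a point; the second argument is a dummy.
  let gR : I → I → I → ℝ := fun u _ y => if (u : ℝ) ≤ y ∧ (y : ℝ) ≤ u + t then 1 else 0
  let gL : I → I → I → ℝ := fun u _ y => if (u : ℝ) - t ≤ y ∧ (y : ℝ) ≤ u then 1 else 0
  let gS : I → I → I → ℝ := fun u v y => (f u y - f v y) ^ 2
  have hgR : Measurable fun p : (I × I) × I => gR p.1.1 p.1.2 p.2 := by
    refine Measurable.ite ?_ measurable_const measurable_const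
    rw [ofPred_and]
    refine (measurableSet_le ?_ ?_).inter (measurableSet_le ?_ ?_) <;> fun_prop
  have hgL : Measurable fun p : (I × I) × I => gL p.1.1 p.1.2 p.2 := by
    refine Measurable.ite ?_ measurable_const measurable_const
    rw [ofPred_and]
    refine (measurableSet_le ?_ ?_).inter (measurableSet_le ?_ ?_) <;> fun_prop
  have hgS : Measurable fun p : (I × I) × I => gS p.1.1 p.1.2 p.2 := by
    have h1 : Measurable fun p : (I × I) × I => f p.1.1 p.2 :=
      hfm.comp ((measurable_fst.comp measurable_fst).prodMk measurable_snd)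
    have h2 : Measurable fun p : (I × I) × I => f p.1.2 p.2 :=
      hfm.comp ((measurable_snd.comp measurable_fst).prodMk measurable_snd)
    exact (h1.sub h2).pow_const 2
  have hR01 : ∀ u v y, gR u v y ∈ Icc (0 : ℝ) 1 := by
    intro u v y; simp only [gR]; split_ifs <;> simp
  have hL01 : ∀ u v y, gL u v y ∈ Icc (0 : ℝ) 1 := by
    intro u v y; simp only [gL]; split_ifs <;> simp
  have hS01 : ∀ u v y, gS u v y ∈ Icc (0 : ℝ) 1 := by
    intro u v y
    obtain ⟨h1, h2⟩ := hf u y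
    obtain ⟨h3, h4⟩ := hf v y
    refine ⟨sq_nonneg _, ?_⟩
    rw [sq_le_one_iff_abs_le_one, abs_le]
    constructor <;> linarith
  let bad (g : I → I → I → ℝ) (i k : Fin n) : Set (Fin n → I) :=
    {x | τ < ∑ m with ¬(m = i ∨ m = k), ((∫ y, g (x i) (x k) y) - g (x i) (x k) (x m))}
  let B : Set (Fin n → I) := (⋃ i, bad gR i i) ∪ (⋃ i, bad gL i i) ∪ ⋃ p : Fin n × Fin n, bad gS p.1 p.2
  have hBm : MeasurableSet B := by
    refine (MeasurableSet.union ?_ ?_).union ?_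
    · exact MeasurableSet.iUnion fun i => measurableSet_latent_sum hgR i i τ
    · exact MeasurableSet.iUnion fun i => measurableSet_latent_sum hgL i i τ
    · exact MeasurableSet.iUnion fun p => measurableSet_latent_sum hgS p.1 p.2 τ
  have hn0 : (0 : ℝ) < n := by exact_mod_cast hn
  refine ⟨X₀ ∩ Bᶜ, hX₀m.inter hBm.compl, ?_, ?_⟩
  · rintro x ⟨hx0, hxB⟩
    simp only [B, mem_compl_iff, mem_union, mem_iUnion, not_or, not_exists] at hxB
    obtain ⟨⟨hxR, hxL⟩, hxS⟩ := hxB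
    refine ⟨hX₀b x hx0, ?_, ?_⟩
    · intro i m hi
      obtain ⟨hb0, hb1⟩ := hi
      have hend := block_subset hb m
      -- A block longer than `2 * t` has room for an interval of length `t` on at least one side of
      -- `x i`.
      by_cases hright : (x i : ℝ) + t < b m.succ
      · refine ⟨Finset.univ.filter fun k : Fin n => k ≠ i ∧ (x i : ℝ) ≤ (x k : ℝ) ∧
          (x k : ℝ) ≤ x i + t, ?_, ?_⟩
        rotate_left
        · refine fun k hk => ?_
          have hk' := (Finset.mem_filter.1 hk).2
          exact ⟨hk'.1, ⟨by linarith [hk'.2.1], by linarith [hk'.2.2]⟩,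
            abs_le.2 ⟨by linarith [hk'.2.1], by linarith [hk'.2.2]⟩⟩
        have := card_window_ge (x := x) (i := i) (lo := x i) (hi := x i + t) (x i).2.1 (by linarith)
          (hright.le.trans (by
            have h1 := hb.strictMono.monotone (Fin.le_last m.succ)
            rwa [hb.last] at h1)) (not_lt.1 (hxR i))
        exact (Nat.cast_le (α := ℝ)).1 (by linarith)
      · have hleft : b m.castSucc < (x i : ℝ) - t := by linarith [htb m]
        refine ⟨Finset.univ.filter fun k : Fin n => k ≠ i ∧ (x i : ℝ) - t ≤ (x k : ℝ) ∧
          (x k : ℝ) ≤ x i, ?_, ?_⟩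
        rotate_left
        · refine fun k hk => ?_
          have hk' := (Finset.mem_filter.1 hk).2
          exact ⟨hk'.1, ⟨by linarith [hk'.2.1], by linarith [hk'.2.2]⟩,
            abs_le.2 ⟨by linarith [hk'.2.1], by linarith [hk'.2.2]⟩⟩
        have := card_window_ge (x := x) (i := i) (lo := x i - t) (hi := x i)
          (by
            have h1 := hb.strictMono.monotone (Fin.zero_le m.castSucc)
            rw [hb.first] at h1
            linarith) (by linarith)
          (x i).2.2 (not_lt.1 (hxL i))
        exact (Nat.cast_le (α := ℝ)).1 (by linarith)
    · intro i k
      have h1 : ∑ m with ¬(m = i ∨ m = k), ((∫ y, gS (x i) (x k) y) - gS (x i) (x k) (x m)) ≤ τ :=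
        not_lt.1 (hxS (i, k))
      have hE : ∫ y, gS (x i) (x k) y ∈ Icc (0 : ℝ) 1 := by
        refine ⟨integral_nonneg fun y => (hS01 _ _ y).1, ?_⟩
        have := integral_mono_of_nonneg (μ := (volume : Measure I)) (f := gS (x i) (x k))
          (g := fun _ => 1) (Filter.Eventually.of_forall fun y => (hS01 _ _ y).1)
          (integrable_const _) (Filter.Eventually.of_forall fun y => (hS01 _ _ y).2)
        simpa using this
      -- Restoring the indices `i` and `k` costs at most 1 each.
      have h2 : ∑ m, ((∫ y, gS (x i) (x k) y) - gS (x i) (x k) (x m)) ≤ τ + 2 := by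
        rw [← Finset.sum_filter_not_add_sum_filter _ (fun m : Fin n => m = i ∨ m = k)]
        refine add_le_add h1 ?_
        refine (Finset.sum_le_card_nsmul _ _ 1 fun m _ => ?_).trans ?_
        · linarith [hE.2, (hS01 (x i) (x k) (x m)).1]
        · have : (Finset.univ.filter fun m : Fin n => m = i ∨ m = k).card ≤ 2 := by
            refine (Finset.card_le_card (t := {i, k}) ?_).trans Finset.card_le_two
            intro m hm
            simpa using hm
          simp only [nsmul_eq_mul, mul_one]
          exact_mod_cast this
      rw [Finset.sum_sub_distrib, Finset.sum_const, Finset.card_univ, Fintype.card_fin,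
        nsmul_eq_mul] at h2
      change ∫ y, gS (x i) (x k) y ≤ (∑ m, gS (x i) (x k) (x m)) / n + s
      have h3 : ∫ y, gS (x i) (x k) y ≤ (∑ m, gS (x i) (x k) (x m) + (τ + 2)) / n := by
        rw [le_div_iff₀ hn0]
        linarith
      rw [add_div] at h3
      linarith
  · set q := ENNReal.ofReal (Real.exp (-2 * τ ^ 2 / n)) with hq
    have e1 : latentLaw n (⋃ i, bad gR i i) ≤ n * q := by
      refine (measure_iUnion_fintype_le _ _).trans
        ((Finset.sum_le_sum fun i _ => latentLaw_sum_ge_le hgR hR01 i i hτ).trans ?_)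
      simp [hq]
    have e2 : latentLaw n (⋃ i, bad gL i i) ≤ n * q := by
      refine (measure_iUnion_fintype_le _ _).trans
        ((Finset.sum_le_sum fun i _ => latentLaw_sum_ge_le hgL hL01 i i hτ).trans ?_)
      simp [hq]
    have e3 : latentLaw n (⋃ p : Fin n × Fin n, bad gS p.1 p.2) ≤ n ^ 2 * q := by
      refine (measure_iUnion_fintype_le _ _).trans
        ((Finset.sum_le_sum fun p _ => latentLaw_sum_ge_le hgS hS01 p.1 p.2 hτ).trans ?_)
      simp [hq, sq]
    calc latentLaw n (X₀ ∩ Bᶜ)ᶜ ≤ latentLaw n X₀ᶜ + latentLaw n B := by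
          rw [compl_inter, compl_compl]
          exact measure_union_le _ _
      _ ≤ 0 + ((n * q + n * q) + n ^ 2 * q) := by
          rw [hX₀]
          gcongr
          exact (measure_union_le _ _).trans
            (add_le_add ((measure_union_le _ _).trans (add_le_add e1 e2)) e3)
      _ = _ := by
          rw [ENNReal.ofReal_mul (by positivity), ← hq,
            ENNReal.ofReal_add (by positivity) (by positivity), ENNReal.ofReal_pow (by positivity),
            ENNReal.ofReal_mul (by norm_num), ENNReal.ofReal_natCast]
          simp
          ring

/-! ### Consequences of the graphon conditions for rows. -/

namespace IsBlockGraphon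

variable {K : ℕ} {b : Fin (K + 1) → ℝ} {η₀ L η δ : ℝ} {κ : ℝ → ℝ} {f : I → I → ℝ}

theorem mem_Icc (hf : IsBlockGraphon b η₀ L η δ κ f) (hη₀ : 0 < η₀) (u v : I) :
    f u v ∈ Icc (0 : ℝ) 1 := by
  obtain ⟨h1, h2⟩ := hf.nondegenerate u v
  exact ⟨by linarith, by linarith⟩

/-- No sign of `L` is assumed; `|L|` keeps later products monotone. -/
theorem abs_sub_le (hf : IsBlockGraphon b η₀ L η δ κ f) {m : Fin K} {u u' : I}
    (hu : (u : ℝ) ∈ block b m) (hu' : (u' : ℝ) ∈ block b m) (y : I) :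
    |f u y - f u' y| ≤ |L| * |(u : ℝ) - u'| :=
  (hf.lipschitz m u u' hu hu' y).trans
    (mul_le_mul_of_nonneg_right (le_abs_self L) (abs_nonneg _))

theorem integrable_sq_sub (hf : IsBlockGraphon b η₀ L η δ κ f) (hη₀ : 0 < η₀) (u v : I) :
    Integrable fun y : I => (f u y - f v y) ^ 2 := by
  have h1 : ∀ w : I, Measurable (f w) := fun w =>
    hf.measurable.comp (measurable_const.prodMk measurable_id)
  refine Integrable.of_mem_Icc 0 1 (((h1 u).sub (h1 v)).pow_const 2).aemeasurable
    (Filter.Eventually.of_forall fun y => ?_)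
  obtain ⟨h1, h2⟩ := hf.mem_Icc hη₀ u y
  obtain ⟨h3, h4⟩ := hf.mem_Icc hη₀ v y
  refine ⟨sq_nonneg _, ?_⟩
  rw [sq_le_one_iff_abs_le_one, abs_le]
  constructor <;> linarith

/-- Rows of different blocks are separated in `L²`. -/
theorem le_integral_of_ne (hf : IsBlockGraphon b η₀ L η δ κ f) (hη₀ : 0 < η₀) (hη : 0 < η)
    {m m' : Fin K} (hm : m ≠ m') {u u' : I}
    (hu : (u : ℝ) ∈ block b m) (hu' : (u' : ℝ) ∈ block b m') :
    η ^ 2 * δ ≤ ∫ y, (f u y - f u' y) ^ 2 := by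
  have h1 := mul_meas_ge_le_integral_of_nonneg
    (Filter.Eventually.of_forall fun y => sq_nonneg (f u y - f u' y))
    (hf.integrable_sq_sub hη₀ u u') (η ^ 2)
  refine le_trans ?_ h1
  refine mul_le_mul_of_nonneg_left ((hf.separated m m' hm u u' hu hu').trans ?_) (sq_nonneg η)
  refine measureReal_mono fun y hy => ?_
  have hy' : η ≤ |f u y - f u' y| := hy
  have : η ^ 2 ≤ |f u y - f u' y| ^ 2 := by gcongr
  rw [sq_abs] at this
  exact this

end IsBlockGraphon

/-! ### The two-hop kernel and the neighbourhood bias. -/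

/-- The conditional mean of the two-hop matrix with vertex `j` deleted, as a kernel on `[0,1]`. -/
noncomputable def hopMean (f : I → I → ℝ) (x : Fin n → I) (j : Fin n) (u v : I) : ℝ :=
  (∑ m ∈ Finset.univ.erase j, f u (x m) * f (x m) v) / ((n : ℝ) - 1)

theorem card_erase_univ (j : Fin n) : ((Finset.univ.erase j).card : ℝ) = (n : ℝ) - 1 := by
  have hn : 1 ≤ n := Nat.one_le_of_lt j.2
  rw [Finset.card_erase_of_mem (Finset.mem_univ j), Finset.card_univ, Fintype.card_fin,
    Nat.cast_sub hn, Nat.cast_one]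

theorem hopMean_comm {f : I → I → ℝ} (hsymm : ∀ u v, f u v = f v u) (x : Fin n → I) (j : Fin n)
    (u v : I) : hopMean f x j u v = hopMean f x j v u := by
  unfold hopMean
  congr 1
  refine Finset.sum_congr rfl fun m _ => ?_
  rw [hsymm u, hsymm _ v, mul_comm]

/-- The kernel inherits the closeness of two rows of `f`, since the other factor is at most 1. -/
theorem abs_hopMean_sub_le {f : I → I → ℝ} (hf : ∀ u v, f u v ∈ Icc (0 : ℝ) 1) (x : Fin n → I)
    (j : Fin n) {u u' : I} {B : ℝ} (hn : 1 < n) (hB : ∀ y, |f u y - f u' y| ≤ B) (v : I) :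
    |hopMean f x j u v - hopMean f x j u' v| ≤ B := by
  have hn' : (0 : ℝ) < (n : ℝ) - 1 := by
    have : (1 : ℝ) < n := by exact_mod_cast hn
    linarith
  unfold hopMean
  rw [← sub_div, ← Finset.sum_sub_distrib, abs_div, abs_of_pos hn', div_le_iff₀ hn']
  refine (Finset.abs_sum_le_sum_abs _ _).trans
    ((Finset.sum_le_card_nsmul _ _ B fun m _ => ?_).trans ?_)
  · rw [← sub_mul, abs_mul, abs_of_nonneg (hf (x m) v).1]
    exact (mul_le_of_le_one_right (abs_nonneg _) (hf (x m) v).2).trans (hB _)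
  · rw [nsmul_eq_mul, card_erase_univ, mul_comm]

/-- Expanding the square and using symmetry expresses row distances through the kernel. This is why
two-hop similarity detects similar rows. -/
theorem sum_sq_sub_eq_hopMean {f : I → I → ℝ} (hsymm : ∀ u v, f u v = f v u) (x : Fin n → I)
    (j : Fin n) (u v : I) :
    (∑ m ∈ Finset.univ.erase j, (f u (x m) - f v (x m)) ^ 2) / ((n : ℝ) - 1) =
      (hopMean f x j u u - hopMean f x j v u) + (hopMean f x j v v - hopMean f x j u v) := by
  unfold hopMean
  rw [← sub_div, ← sub_div, ← add_div, ← Finset.sum_sub_distrib, ← Finset.sum_sub_distrib,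
    ← Finset.sum_add_distrib]
  congr 1
  refine Finset.sum_congr rfl fun m _ => ?_
  rw [hsymm (x m) u, hsymm (x m) v]
  ring

theorem abs_twoHop_sub_hopMean_le {f : I → I → ℝ} {x : Fin n → I} {H : SimpleGraph (Fin n)}
    {j i l : Fin n} {T : ℝ} (hn : 1 < n)
    (hT : |∑ m ∈ Finset.univ.erase j,
      (adj H i m * adj H m l - f (x i) (x m) * f (x m) (x l))| ≤ T) :
    |twoHop H j i l - hopMean f x j (x i) (x l)| ≤ T / ((n : ℝ) - 1) := by
  have hn' : (0 : ℝ) < (n : ℝ) - 1 := by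
    have : (1 : ℝ) < n := by exact_mod_cast hn
    linarith
  unfold twoHop hopMean
  rw [← sub_div, ← Finset.sum_sub_distrib, abs_div, abs_of_pos hn']
  gcongr

theorem abs_twoHop_sub_le_dist (H : SimpleGraph (Fin n)) {j i k l : Fin n}
    (hi : l ≠ i) (hk : l ≠ k) (hj : l ≠ j) :
    |twoHop H j i l - twoHop H j k l| ≤ dist H j i k :=
  le_ciSup (f := fun ℓ : {ℓ : Fin n // ℓ ≠ i ∧ ℓ ≠ k ∧ ℓ ≠ j} =>
    |twoHop H j i ℓ - twoHop H j k ℓ|) (Set.finite_range _).bddAbove ⟨l, hi, hk, hj⟩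

/-- Supplies a nearby vertex whose column is allowed in the two-hop distance. -/
theorem exists_mem_ne_ne {W : Finset (Fin n)} (hW : 3 ≤ W.card) (j k : Fin n) :
    ∃ l ∈ W, l ≠ j ∧ l ≠ k := by
  by_contra! hc
  have : W ⊆ {j, k} := by
    intro l hl
    by_cases h : l = j
    · simp [h]
    · simp [hc l hl h]
  have := (Finset.card_le_card this).trans Finset.card_le_two
  omega

theorem abs_sub_localAverage_le {f : I → I → ℝ} {x : Fin n → I} {H : SimpleGraph (Fin n)} {h : ℕ}
    {i j : Fin n} (hij : i ≠ j) (h0 : 0 < h) (hn : h ≤ n - 2) {B : ℝ}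
    (hB : ∀ k ∈ nbhd H h i j, |f (x i) (x j) - f (x k) (x j)| ≤ B) :
    |f (x i) (x j) - localAverage f x H h i j| ≤ B := by
  have hh : (0 : ℝ) < h := by exact_mod_cast h0
  have : f (x i) (x j) - localAverage f x H h i j =
      (∑ k ∈ nbhd H h i j, (f (x i) (x j) - f (x k) (x j))) / h := by
    unfold localAverage
    rw [Finset.sum_sub_distrib, Finset.sum_const, card_nbhd H hij hn, nsmul_eq_mul]
    field_simp
  rw [this, abs_div, abs_of_pos hh, div_le_iff₀ hh]
  refine (Finset.abs_sum_le_sum_abs _ _).trans ((Finset.sum_le_card_nsmul _ _ B hB).trans ?_)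
  rw [card_nbhd H hij hn, nsmul_eq_mul, mul_comm]

/-- For regular latent positions and a concentrated two-hop matrix, the neighbourhoods are made of
vertices with close latent positions. -/
theorem biasBound_of_regular {K : ℕ} {b : Fin (K + 1) → ℝ} {η₀ L η δ : ℝ} {κ : ℝ → ℝ}
    {f : I → I → ℝ} (hf : IsBlockGraphon b η₀ L η δ κ f) (hη₀ : 0 < η₀) (hη : 0 < η)
    {ε : ℝ} (hε : 0 < ε) (hκ : 0 < κ ε) {h : ℕ} (h2 : 2 ≤ h) (hn : h ≤ n - 2)
    {t s T : ℝ} (ht : 0 ≤ t) (hT0 : 0 ≤ T) {x : Fin n → I} (hx : LatentRegular b f (h + 2) t s x)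
    {H : SimpleGraph (Fin n)}
    (hT : ∀ j i l : Fin n, i ≠ l → |∑ m ∈ Finset.univ.erase j,
      (adj H i m * adj H m l - f (x i) (x m) * f (x m) (x l))| ≤ T)
    {R : ℝ} (hR : 8 * (T / ((n : ℝ) - 1)) + 6 * (|L| * t) + 1 / n + s ≤ R)
    (hRη : R < η ^ 2 * δ) :
    BiasBound b ε f h (|L| * Real.sqrt (R / κ ε)) x H := by
  intro i j hgood
  obtain ⟨hij, hi, -⟩ := hgood
  have hn1 : 1 < n := by omega
  have hnpos : (0 : ℝ) < n := by exact_mod_cast (by omega : 0 < n)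
  have hn1' : (0 : ℝ) < (n : ℝ) - 1 := by
    have : (1 : ℝ) < n := by exact_mod_cast hn1
    linarith
  have hf01 := hf.mem_Icc hη₀
  set e := T / ((n : ℝ) - 1) with he
  have he0 : 0 ≤ e := by positivity
  have hLt : 0 ≤ |L| * t := by positivity
  have hlip : ∀ {m : Fin K} {a c : Fin n}, (x a : ℝ) ∈ block b m → (x c : ℝ) ∈ block b m →
      |(x a : ℝ) - x c| ≤ t → ∀ v, |hopMean f x j (x a) v - hopMean f x j (x c) v| ≤ |L| * t := by
    intro m a c ha hc hac v
    refine abs_hopMean_sub_le hf01 x j hn1 (fun y => ?_) v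
    exact (hf.abs_sub_le ha hc y).trans (mul_le_mul_of_nonneg_left hac (abs_nonneg L))
  have hconc : ∀ {a l : Fin n}, a ≠ l →
      |twoHop H j a l - hopMean f x j (x a) (x l)| ≤ e :=
    fun hal => abs_twoHop_sub_hopMean_le hn1 (hT j _ _ hal)
  obtain ⟨m, him⟩ := mem_iUnion.1 hi
  have him' := blockInterior_subset hε m him
  obtain ⟨W, hWc, hW⟩ := hx.window i m him'
  have hdist : ∀ k ∈ nbhd H h i j, dist H j i k ≤ |L| * t + 2 * e := by
    intro k hk
    -- Deleting `j` from the window leaves at least `h` vertices, all at small two-hop distance from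
    -- `i`.
    refine dist_le_of_mem_nbhd (s := W.erase j) ?_ ?_ hk
    · have := Finset.pred_card_le_card_erase (s := W) (a := j)
      omega
    · intro k' hk'
      obtain ⟨hkj, hkW⟩ := Finset.mem_erase.1 hk'
      obtain ⟨hki, hkb, hkt⟩ := hW k' hkW
      refine ⟨hki, hkj, Real.iSup_le (fun l => ?_) (by positivity)⟩
      obtain ⟨l, hli, hlk, hlj⟩ := l
      have e1 := abs_le.1 (hconc (a := i) (l := l) hli.symm)
      have e2 := abs_le.1 (hconc (a := k') (l := l) hlk.symm)
      have e3 := abs_le.1 (hlip hkb him' hkt (x l))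
      rw [abs_le]
      constructor <;> simp only [] <;> linarith [e1.1, e1.2, e2.1, e2.2, e3.1, e3.2]
  refine abs_sub_localAverage_le hij (by omega) hn fun k hk => ?_
  obtain ⟨hki, hkj⟩ := ne_of_mem_nbhd hk
  have hd := hdist k hk
  obtain ⟨m', hkm⟩ := hx.mem_block k
  obtain ⟨W', hWc', hW'⟩ := hx.window k m' hkm
  -- Replacing both two-hop entries by kernel values adds `2 * e` to the distance bound.
  have hQ : ∀ l, l ≠ i → l ≠ k → l ≠ j →
      |hopMean f x j (x i) (x l) - hopMean f x j (x k) (x l)| ≤ |L| * t + 4 * e := by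
    intro l hli hlk hlj
    have e1 := abs_le.1 (hconc (a := i) (l := l) hli.symm)
    have e2 := abs_le.1 (hconc (a := k) (l := l) hlk.symm)
    have e3 := abs_le.1 ((abs_twoHop_sub_le_dist H hli hlk hlj).trans hd)
    rw [abs_le]
    constructor <;> linarith [e1.1, e1.2, e2.1, e2.2, e3.1, e3.2]
  have hcomm := hopMean_comm hf.symm x j
  -- Column `i` is excluded from `dist`, so a window vertex `l` near `i` stands in for it. The two
  -- replacements cost `|L| * t` each, and `hQ` at `l` costs the rest.
  have hA : hopMean f x j (x i) (x i) - hopMean f x j (x k) (x i) ≤ 3 * (|L| * t) + 4 * e := by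
    obtain ⟨l, hlW, hlj, hlk⟩ := exists_mem_ne_ne (by omega : 3 ≤ W.card) j k
    obtain ⟨hli, hlb, hlt⟩ := hW l hlW
    have e1 := abs_le.1 (hlip hlb him' hlt (x i))
    have e2 := abs_le.1 (hlip hlb him' hlt (x k))
    have e3 := abs_le.1 (hQ l hli hlk hlj)
    have c1 := hcomm (x l) (x i)
    have c2 := hcomm (x l) (x k)
    have c3 := hcomm (x i) (x k)
    linarith [e1.1, e2.2, e3.2]
  have hB : hopMean f x j (x k) (x k) - hopMean f x j (x i) (x k) ≤ 3 * (|L| * t) + 4 * e := by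
    obtain ⟨l, hlW, hlj, hli⟩ := exists_mem_ne_ne (by omega : 3 ≤ W'.card) j i
    obtain ⟨hlk, hlb, hlt⟩ := hW' l hlW
    have e1 := abs_le.1 (hlip hlb hkm hlt (x i))
    have e2 := abs_le.1 (hlip hlb hkm hlt (x k))
    have e3 := abs_le.1 (hQ l hli hlk hlj)
    have c1 := hcomm (x l) (x i)
    have c2 := hcomm (x l) (x k)
    have c3 := hcomm (x i) (x k)
    linarith [e1.2, e2.1, e3.1]
  have hemp : ∑ l ∈ Finset.univ.erase j, (f (x i) (x l) - f (x k) (x l)) ^ 2 ≤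
      (6 * (|L| * t) + 8 * e) * n := by
    have h1 := sum_sq_sub_eq_hopMean hf.symm x j (x i) (x k)
    rw [div_eq_iff hn1'.ne'] at h1
    rw [h1]
    have : (0 : ℝ) ≤ 6 * (|L| * t) + 8 * e := by positivity
    calc _ ≤ (6 * (|L| * t) + 8 * e) * ((n : ℝ) - 1) :=
          mul_le_mul_of_nonneg_right (by linarith) hn1'.le
      _ ≤ _ := mul_le_mul_of_nonneg_left (by linarith) this
  have hone : (f (x i) (x j) - f (x k) (x j)) ^ 2 ≤ 1 := by
    obtain ⟨h1, h2⟩ := hf01 (x i) (x j)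
    obtain ⟨h3, h4⟩ := hf01 (x k) (x j)
    rw [sq_le_one_iff_abs_le_one, abs_le]
    constructor <;> linarith
  have hint : ∫ y, (f (x i) y - f (x k) y) ^ 2 ≤ R := by
    refine (hx.rows i k).trans (le_trans ?_ hR)
    -- The kernel identity misses the deleted vertex `j`, whose term costs at most `1 / n`.
    rw [← Finset.add_sum_erase _ _ (Finset.mem_univ j), add_div]
    have h1 : (f (x i) (x j) - f (x k) (x j)) ^ 2 / n ≤ 1 / (n : ℝ) := by gcongr
    have h2 : (∑ l ∈ Finset.univ.erase j, (f (x i) (x l) - f (x k) (x l)) ^ 2) / (n : ℝ) ≤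
        6 * (|L| * t) + 8 * e := by
      rwa [div_le_iff₀ hnpos]
    linarith
  -- Different blocks would force an L² gap of at least `η ^ 2 * δ`, which exceeds `R`.
  have hmm : m = m' := by
    by_contra hne
    linarith [hf.le_integral_of_ne hη₀ hη hne him' hkm]
  subst hmm
  refine (hf.abs_sub_le him' hkm _).trans (mul_le_mul_of_nonneg_left ?_ (abs_nonneg L))
  refine Real.le_sqrt_of_sq_le ?_
  rw [le_div_iff₀ hκ, mul_comm]
  exact (hf.identifiable ε hε m (x i) (x k) him hkm).trans hint

/-! ### Coverage, measurability and the probability of a good edge. -/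

theorem smoother_mem_Icc (H : SimpleGraph (Fin n)) {h : ℕ} {i j : Fin n} (hij : i ≠ j)
    (hn : h ≤ n - 2) : smoother H h i j ∈ Icc (0 : ℝ) 1 := by
  unfold smoother
  refine ⟨div_nonneg (Finset.sum_nonneg fun k _ => (adj_mem_Icc H k j).1) (Nat.cast_nonneg h), ?_⟩
  refine div_le_one_of_le₀ ?_ (Nat.cast_nonneg h)
  refine (Finset.sum_le_card_nsmul _ _ 1 fun k _ => (adj_mem_Icc H k j).2).trans ?_
  rw [card_nbhd H hij hn]
  simp

/-- The smoother is itself a point of the interval, so it serves as the first summand of the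
Minkowski sum. Only nonnegativity of the half-width enters. -/
theorem covers_of_abs_sub_smoother_le {f : I → I → ℝ} {x : Fin n → I} {H : SimpleGraph (Fin n)}
    {h : ℕ} {α B : ℝ} {i j : Fin n} (hα : 0 < α) (hα' : α < 1) (hij : i ≠ j) (h2 : 2 ≤ h)
    (hn : h ≤ n - 2) (hB : |f (x i) (x j) - smoother H h i j| ≤ B) :
    Covers f h α B i j x H := by
  have hh : (2 : ℝ) ≤ h := by exact_mod_cast h2
  have hlog : 0 ≤ Real.log (4 / α) := Real.log_nonneg (by rw [le_div_iff₀ hα]; linarith)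
  have hw : 0 ≤ halfWidth H h α i j :=
    add_nonneg (Real.sqrt_nonneg _) (div_nonneg (by positivity) (by linarith))
  refine mem_add.2 ⟨smoother H h i j, ⟨⟨by linarith, by linarith⟩, smoother_mem_Icc H hij hn⟩,
    f (x i) (x j) - smoother H h i j, abs_le.1 hB, by ring⟩

theorem graphWeight_nonneg {f : I → I → ℝ} (hf : ∀ u v, f u v ∈ Icc (0 : ℝ) 1) (x : Fin n → I)
    (H : SimpleGraph (Fin n)) : 0 ≤ graphWeight f x H := by
  unfold graphWeight
  refine Finset.prod_nonneg fun e _ => ?_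
  split_ifs
  · exact (hf _ _).1
  · linarith [(hf (x e.1) (x e.2)).2]

theorem measurable_eval₂ {f : I → I → ℝ} (hfm : Measurable (Function.uncurry f)) (i j : Fin n) :
    Measurable fun x : Fin n → I => f (x i) (x j) := by
  have h : Measurable fun x : Fin n → I => (x i, x j) := by fun_prop
  exact hfm.comp h

theorem measurable_graphWeight {f : I → I → ℝ} (hfm : Measurable (Function.uncurry f))
    (H : SimpleGraph (Fin n)) : Measurable fun x : Fin n → I => graphWeight f x H := by
  unfold graphWeight
  refine Finset.measurable_prod _ fun e _ => ?_
  split_ifs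
  · exact measurable_eval₂ hfm e.1 e.2
  · exact measurable_const.sub (measurable_eval₂ hfm e.1 e.2)

theorem measurableSet_regularInterior {K : ℕ} (b : Fin (K + 1) → ℝ) (ε : ℝ) :
    MeasurableSet (regularInterior b ε) := MeasurableSet.iUnion fun _ => measurableSet_Icc

theorem measurableSet_goodEdge {K : ℕ} (b : Fin (K + 1) → ℝ) (ε : ℝ) (i j : Fin n) :
    MeasurableSet {x : Fin n → I | GoodEdge b ε x i j} := by
  have h : ∀ i : Fin n, MeasurableSet {x : Fin n → I | (x i : ℝ) ∈ regularInterior b ε} := fun i =>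
    (measurable_subtype_coe.comp (measurable_pi_apply i)) (measurableSet_regularInterior b ε)
  unfold GoodEdge
  rw [ofPred_and, ofPred_and]
  exact (MeasurableSet.const _).inter ((h i).inter (h j))

theorem measurableSet_not_biasBound {K : ℕ} (b : Fin (K + 1) → ℝ) (ε : ℝ) {f : I → I → ℝ}
    (hfm : Measurable (Function.uncurry f)) (h : ℕ) (B : ℝ) (H : SimpleGraph (Fin n)) :
    MeasurableSet {x : Fin n → I | ¬BiasBound b ε f h B x H} := by
  have : {x : Fin n → I | ¬BiasBound b ε f h B x H} = ⋃ i, ⋃ j,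
      {x : Fin n → I | GoodEdge b ε x i j} ∩
        {x | B < |f (x i) (x j) - localAverage f x H h i j|} := by
    ext x
    simp [BiasBound]
  rw [this]
  refine MeasurableSet.iUnion fun i => MeasurableSet.iUnion fun j =>
    (measurableSet_goodEdge b ε i j).inter (measurableSet_lt measurable_const ?_)
  refine Measurable.abs ((measurable_eval₂ hfm i j).sub ?_)
  exact (Finset.measurable_sum _ fun k _ => measurable_eval₂ hfm k j).div_const _

theorem volume_regularInterior_ge {K : ℕ} {b : Fin (K + 1) → ℝ} (hb : IsPartition b) {ε : ℝ}
    (hε : 0 < ε) (m : Fin K) (hm : 2 * ε < b m.succ - b m.castSucc) :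
    ENNReal.ofReal (b m.succ - b m.castSucc - 2 * ε) ≤
      (volume : Measure I) {y : I | (y : ℝ) ∈ regularInterior b ε} := by
  have h0 := hb.strictMono.monotone (Fin.zero_le m.castSucc)
  have h1 := hb.strictMono.monotone (Fin.le_last m.succ)
  rw [hb.first] at h0
  rw [hb.last] at h1
  let u : I := ⟨b m.castSucc + ε, by linarith, by linarith⟩
  let v : I := ⟨b m.succ - ε, by linarith, by linarith⟩
  have h2 : (volume : Measure I) (Icc u v) = ENNReal.ofReal (b m.succ - b m.castSucc - 2 * ε) := by
    rw [unitInterval.volume_Icc]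
    congr 1
    simp only [u, v]
    ring
  rw [← h2]
  exact measure_mono fun y hy => mem_iUnion.2 ⟨m, hy.1, hy.2⟩

/-- A lower bound free of `n` for the conditioning event: by independence, both positions fall in
the interior of one block with at least the product of its lengths. -/
theorem latentLaw_goodEdge_ge {K : ℕ} {b : Fin (K + 1) → ℝ} (hb : IsPartition b) {ε : ℝ}
    (hε : 0 < ε) (m : Fin K) (hm : 2 * ε < b m.succ - b m.castSucc) {i j : Fin n} (hij : i ≠ j) :
    ENNReal.ofReal ((b m.succ - b m.castSucc - 2 * ε) ^ 2) ≤
      latentLaw n {x | GoodEdge b ε x i j} := by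
  set R : Set I := {y : I | (y : ℝ) ∈ regularInterior b ε} with hR
  have hRm : MeasurableSet R := measurable_subtype_coe (measurableSet_regularInterior b ε)
  have hind : ProbabilityTheory.iIndepFun (fun (k : Fin n) (x : Fin n → I) => x k) (latentLaw n) :=
    ProbabilityTheory.iIndepFun_pi (X := fun _ y => y) (fun _ => aemeasurable_id)
  have h1 := (hind.indepFun hij).measure_inter_preimage_eq_mul R R hRm hRm
  have h2 : ∀ k : Fin n, latentLaw n ((fun x => x k) ⁻¹' R) = volume R := fun k =>
    (measurePreserving_eval (fun _ : Fin n => (volume : Measure I)) k).measure_preimage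
      hRm.nullMeasurableSet
  rw [h2, h2] at h1
  have h3 : {x : Fin n → I | GoodEdge b ε x i j} = (fun x => x i) ⁻¹' R ∩ (fun x => x j) ⁻¹' R := by
    ext x
    simp [GoodEdge, hij, hR]
  rw [h3, h1, sq, ENNReal.ofReal_mul (by linarith)]
  gcongr <;> exact volume_regularInterior_ge hb hε m hm

/-! ### From conditional to joint probabilities. -/

section Sample

variable {f : I → I → ℝ} {Ω : Type*} [MeasurableSpace Ω] {μ : Measure Ω}
  {ξ : Ω → Fin n → I} {G : Ω → SimpleGraph (Fin n)}

theorem IsGraphonSample.measure_preimage (hs : IsGraphonSample f μ ξ G) {X : Set (Fin n → I)}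
    (hX : MeasurableSet X) : μ (ξ ⁻¹' X) = latentLaw n X := by
  rw [← Measure.map_apply hs.measurable_latent hX, hs.latent_law]

/-- A joint event is unlikely if, for most latent positions, it is conditionally unlikely. -/
theorem IsGraphonSample.measureReal_le [IsProbabilityMeasure μ] (hs : IsGraphonSample f μ ξ G)
    (hfm : Measurable (Function.uncurry f)) (hf : ∀ u v, f u v ∈ Icc (0 : ℝ) 1)
    {F : SimpleGraph (Fin n) → Set (Fin n → I)} (hF : ∀ H, MeasurableSet (F H))
    {X : Set (Fin n → I)} (hX : MeasurableSet X) {q₁ q₂ : ℝ} (hq₁ : 0 ≤ q₁) (hq₂ : 0 ≤ q₂)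
    (hX₁ : latentLaw n Xᶜ ≤ ENNReal.ofReal q₁)
    (hX₂ : ∀ x ∈ X, condProb f x {H | x ∈ F H} ≤ q₂) :
    μ.real {ω | ξ ω ∈ F (G ω)} ≤ q₁ + q₂ := by
  classical
  have hsub : {ω | ξ ω ∈ F (G ω)} ⊆
      ξ ⁻¹' Xᶜ ∪ ⋃ H : SimpleGraph (Fin n), ξ ⁻¹' (F H ∩ X) ∩ G ⁻¹' {H} := by
    intro ω hω
    by_cases hx : ξ ω ∈ X
    · exact Or.inr (mem_iUnion.2 ⟨G ω, ⟨hω, hx⟩, rfl⟩)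
    · exact Or.inl hx
  -- On `X`, summing the graph weights over the graphs in the event gives back `condProb`.
  have hmain : ∑ H : SimpleGraph (Fin n), μ (ξ ⁻¹' (F H ∩ X) ∩ G ⁻¹' {H}) ≤ ENNReal.ofReal q₂ := by
    have h1 : ∀ H : SimpleGraph (Fin n), μ (ξ ⁻¹' (F H ∩ X) ∩ G ⁻¹' {H}) =
        ∫⁻ x, (F H ∩ X).indicator (fun x => ENNReal.ofReal (graphWeight f x H)) x ∂(latentLaw n) := by
      intro H
      rw [hs.graph_law _ ((hF H).inter hX), lintegral_indicator ((hF H).inter hX)]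
    simp only [h1]
    rw [← lintegral_finsetSum _ fun H _ =>
      (measurable_graphWeight hfm H).ennreal_ofReal.indicator ((hF H).inter hX)]
    refine (lintegral_mono (g := fun _ => ENNReal.ofReal q₂) fun x => ?_).trans (by simp)
    by_cases hx : x ∈ X
    · refine le_trans (le_of_eq ?_) (ENNReal.ofReal_le_ofReal (hX₂ x hx))
      unfold condProb
      rw [ENNReal.ofReal_sum_of_nonneg]
      · refine Finset.sum_congr rfl fun H _ => ?_
        by_cases hxF : x ∈ F H <;> simp [indicator, hx, hxF]
      · intro H _
        split_ifs
        · exact graphWeight_nonneg hf x H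
        · exact le_rfl
    · simp [indicator, hx]
  rw [measureReal_def]
  refine ENNReal.toReal_le_of_le_ofReal (by positivity) ?_
  rw [ENNReal.ofReal_add hq₁ hq₂]
  refine (measure_mono hsub).trans ((measure_union_le _ _).trans (add_le_add ?_ ?_))
  · rwa [hs.measure_preimage hX.compl]
  · exact (measure_iUnion_fintype_le _ _).trans hmain

theorem one_sub_le_measureReal [IsProbabilityMeasure μ] (S : Set Ω) :
    1 - μ.real Sᶜ ≤ μ.real S := by
  have := measureReal_union_le (μ := μ) S Sᶜ
  rw [union_compl_self, probReal_univ] at this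
  linarith

theorem IsGraphonSample.measurableSet_mem (hs : IsGraphonSample f μ ξ G)
    {F : SimpleGraph (Fin n) → Set (Fin n → I)} (hF : ∀ H, MeasurableSet (F H)) :
    MeasurableSet {ω | ξ ω ∈ F (G ω)} := by
  have : {ω | ξ ω ∈ F (G ω)} = ⋃ H : SimpleGraph (Fin n), ξ ⁻¹' F H ∩ G ⁻¹' {H} := by
    ext ω
    simp
  rw [this]
  exact MeasurableSet.iUnion fun H =>
    (hs.measurable_latent (hF H)).inter (hs.measurable_graph H)

/-- From conditional bounds on a likely set of latent positions to the unconditional claims. -/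
theorem IsGraphonSample.bias_and_coverage [IsProbabilityMeasure μ] (hs : IsGraphonSample f μ ξ G)
    (hfm : Measurable (Function.uncurry f)) (hf : ∀ u v, f u v ∈ Icc (0 : ℝ) 1)
    {K : ℕ} {b : Fin (K + 1) → ℝ} {ε α B q r p : ℝ} {h : ℕ} (hα : 0 < α) (hα' : α < 1)
    (h2 : 2 ≤ h) (hn : h ≤ n - 2)
    {X : Set (Fin n → I)} (hXm : MeasurableSet X) (hq : 0 ≤ q)
    (hX : latentLaw n Xᶜ ≤ ENNReal.ofReal q)
    (hbias : ∀ x ∈ X, condProb f x {H | ¬BiasBound b ε f h B x H} ≤ q)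
    (hcov : ∀ x ∈ X, ∀ i j, GoodEdge b ε x i j →
      condProb f x {H | B < |f (x i) (x j) - smoother H h i j|} ≤ q)
    (hp : 0 < p) (hpE : ∀ i j : Fin n, i ≠ j →
      ENNReal.ofReal p ≤ latentLaw n {x | GoodEdge b ε x i j})
    (hqr : 2 * q ≤ r) (hqpr : 2 * q / p ≤ r) :
    1 - r ≤ μ.real {ω | BiasBound b ε f h B (ξ ω) (G ω)} ∧
    (∀ i j : Fin n, i ≠ j →
      1 - α - r ≤ (ProbabilityTheory.cond μ {ω | GoodEdge b ε (ξ ω) i j}).real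
        {ω | Covers f h α B i j (ξ ω) (G ω)}) ∧
    1 - r ≤ μ.real {ω |
      1 - r ≤ condProb f (ξ ω) {H | BiasBound b ε f h B (ξ ω) H} ∧
      ∀ i j : Fin n, GoodEdge b ε (ξ ω) i j →
        1 - α - r ≤ condProb f (ξ ω) {H | Covers f h α B i j (ξ ω) H}} := by
  refine ⟨?_, fun i j hij => ?_, ?_⟩
  · have h1 := hs.measureReal_le hfm hf (F := fun H => {x | ¬BiasBound b ε f h B x H})
      (fun H => measurableSet_not_biasBound b ε hfm h B H) hXm hq hq hX hbias
    have h2 := one_sub_le_measureReal (μ := μ) {ω | BiasBound b ε f h B (ξ ω) (G ω)}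
    have h3 : {ω | BiasBound b ε f h B (ξ ω) (G ω)}ᶜ =
      {ω | ξ ω ∈ (fun H => {x | ¬BiasBound b ε f h B x H}) (G ω)} := rfl
    rw [h3] at h2
    linarith
  · set E : Set Ω := {ω | GoodEdge b ε (ξ ω) i j} with hE
    have hEm : MeasurableSet E := hs.measurable_latent (measurableSet_goodEdge b ε i j)
    have hpE' : p ≤ μ.real E := by
      rw [measureReal_def]
      refine (ENNReal.ofReal_le_iff_le_toReal (measure_ne_top _ _)).1 ?_
      have h3 : μ E = latentLaw n {x | GoodEdge b ε x i j} :=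
        hs.measure_preimage (measurableSet_goodEdge b ε i j)
      rw [h3]
      exact hpE i j hij
    have hE0 : μ E ≠ 0 := by
      intro h0
      rw [measureReal_def, h0, ENNReal.toReal_zero] at hpE'
      linarith
    have hprob := ProbabilityTheory.cond_isProbabilityMeasure hE0
    let D : SimpleGraph (Fin n) → Set (Fin n → I) :=
      fun H => {x | B < |f (x i) (x j) - smoother H h i j|}
    have hDm : ∀ H, MeasurableSet (D H) := fun H =>
      measurableSet_lt measurable_const ((measurable_eval₂ hfm i j).sub measurable_const).abs
    -- The bound `hcov` is available only at good pairs; intersecting with that event makes the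
    -- conditional probability zero elsewhere.
    have h1 := hs.measureReal_le hfm hf (F := fun H => {x | GoodEdge b ε x i j} ∩ D H)
      (fun H => (measurableSet_goodEdge b ε i j).inter (hDm H)) hXm hq hq hX (fun x hx => by
        by_cases hg : GoodEdge b ε x i j
        · refine (condProb_mono hf x ?_).trans (hcov x hx i j hg)
          exact fun H hH => hH.2
        · have : {H : SimpleGraph (Fin n) | x ∈ {x | GoodEdge b ε x i j} ∩ D H} = ∅ := by
            ext H
            simp [hg]
          rw [this]
          simpa [condProb] using hq)
    set S : Set Ω := {ω | ξ ω ∈ D (G ω)} with hS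
    have hsub : Sᶜ ⊆ {ω | Covers f h α B i j (ξ ω) (G ω)} := fun ω hω =>
      covers_of_abs_sub_smoother_le hα hα' hij h2 hn (not_lt.1 hω)
    have hcondS : (ProbabilityTheory.cond μ E).real S ≤ 2 * q / p := by
      rw [measureReal_def, ProbabilityTheory.cond_apply hEm, ENNReal.toReal_mul, ENNReal.toReal_inv,
        ← measureReal_def, ← measureReal_def]
      have h4 : μ.real (E ∩ S) ≤ 2 * q := by
        rw [two_mul]
        exact h1
      rw [inv_mul_eq_div]
      gcongr
    have h5 := probReal_compl_eq_one_sub (μ := ProbabilityTheory.cond μ E)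
      (hs.measurableSet_mem hDm)
    have h6 := measureReal_mono (μ := ProbabilityTheory.cond μ E) hsub
    rw [h5] at h6
    linarith
  · have hgood : X ⊆ {x | 1 - r ≤ condProb f x {H | BiasBound b ε f h B x H} ∧
        ∀ i j : Fin n, GoodEdge b ε x i j →
          1 - α - r ≤ condProb f x {H | Covers f h α B i j x H}} := by
      intro x hx
      refine ⟨?_, fun i j hg => ?_⟩
      · have h1 := condProb_compl hf x {H | ¬BiasBound b ε f h B x H}
        have h2 : {H | ¬BiasBound b ε f h B x H}ᶜ = {H | BiasBound b ε f h B x H} := by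
          ext H
          simp
        rw [h2] at h1
        linarith [hbias x hx]
      · have h1 := condProb_compl hf x {H | B < |f (x i) (x j) - smoother H h i j|}
        have h3 := condProb_mono hf x (E := {H | B < |f (x i) (x j) - smoother H h i j|}ᶜ)
          (F := {H | Covers f h α B i j x H}) fun H hH =>
            covers_of_abs_sub_smoother_le hα hα' hg.1 h2 hn (not_lt.1 hH)
        linarith [hcov x hx i j hg]
    have h1 : 1 - q ≤ μ.real (ξ ⁻¹' X) := by
      refine le_trans ?_ (one_sub_le_measureReal _)
      have : μ.real (ξ ⁻¹' X)ᶜ ≤ q := by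
        rw [← preimage_compl, measureReal_def, hs.measure_preimage hXm.compl]
        exact ENNReal.toReal_le_of_le_ofReal hq hX
      linarith
    refine le_trans (by linarith) (h1.trans (measureReal_mono ?_))
    exact fun ω hω => hgood hω

end Sample

/-! ### The rate and the choice of constants. -/

theorem rate_nonneg (n : ℕ) : 0 ≤ rate n :=
  Real.rpow_nonneg (div_nonneg (Real.log_natCast_nonneg n) (Nat.cast_nonneg n)) _

theorem rate_pos (hn : 2 ≤ n) : 0 < rate n := by
  have : (1 : ℝ) < n := by exact_mod_cast hn
  exact Real.rpow_pos_of_pos (div_pos (Real.log_pos this) (by linarith)) _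

/-- Removes logarithms: with `r = rate n`, the bandwidth scale is `n * r ^ 2` and the exponents are
multiples of `n * r ^ 4`. -/
theorem natCast_mul_rate_pow_four (hn : 2 ≤ n) : n * rate n ^ 4 = Real.log n := by
  have h1 : (1 : ℝ) < n := by exact_mod_cast hn
  have h2 : 0 ≤ Real.log n / n := div_nonneg (Real.log_natCast_nonneg n) (Nat.cast_nonneg n)
  have h3 : rate n ^ 4 = Real.log n / n := by
    unfold rate
    rw [← Real.rpow_natCast, ← Real.rpow_mul h2]
    norm_num
  rw [h3]
  field_simp

theorem sqrt_mul_log_eq (hn : 2 ≤ n) : Real.sqrt (n * Real.log n) = n * rate n ^ 2 := by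
  rw [← natCast_mul_rate_pow_four hn, Real.sqrt_eq_iff_mul_self_eq_of_pos]
  · ring
  · have := rate_pos hn
    have : (1 : ℝ) < n := by exact_mod_cast hn
    positivity

theorem tendsto_rate : Filter.Tendsto rate Filter.atTop (nhds 0) := by
  have h1 : Filter.Tendsto (fun x : ℝ => Real.log x / x) Filter.atTop (nhds 0) := by
    simpa using Real.isLittleO_log_id_atTop.tendsto_div_nhds_zero
  have h2 := (h1.comp tendsto_natCast_atTop_atTop).rpow_const (p := 1 / 4) (Or.inr (by norm_num))
  rw [Real.zero_rpow (by norm_num)] at h2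
  exact h2

theorem exp_neg_mul_log {k : ℕ} (hn : 0 < n) : Real.exp (-(k * Real.log n)) = 1 / (n : ℝ) ^ k := by
  have : (0 : ℝ) < n := by exact_mod_cast hn
  rw [Real.exp_neg, mul_comm, Real.exp_mul, Real.exp_log this, Real.rpow_natCast, one_div]

/-- Given regular latent positions, the neighbourhood bias is small with high probability. -/
theorem condProb_not_biasBound_le {K : ℕ} {b : Fin (K + 1) → ℝ} {η₀ L η δ : ℝ} {κ : ℝ → ℝ}
    {f : I → I → ℝ} (hf : IsBlockGraphon b η₀ L η δ κ f) (hη₀ : 0 < η₀) (hη : 0 < η)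
    {ε : ℝ} (hε : 0 < ε) (hκ : 0 < κ ε) {h : ℕ} (h2 : 2 ≤ h) (hn : h ≤ n - 2)
    {t s τ : ℝ} (ht : 0 ≤ t) (hτ : 0 ≤ τ) {x : Fin n → I} (hx : LatentRegular b f (h + 2) t s x)
    {R : ℝ} (hR : 8 * ((τ + 2) / ((n : ℝ) - 1)) + 6 * (|L| * t) + 1 / n + s ≤ R)
    (hRη : R < η ^ 2 * δ) {B : ℝ} (hB : |L| * Real.sqrt (R / κ ε) ≤ B) :
    condProb f x {H | ¬BiasBound b ε f h B x H} ≤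
      (n : ℝ) ^ 3 * (2 * Real.exp (-2 * τ ^ 2 / n)) := by
  classical
  have hf01 := hf.mem_Icc hη₀
  let bad : Fin n × Fin n × Fin n → Set (SimpleGraph (Fin n)) := fun p =>
    {H | p.2.1 ≠ p.2.2 ∧ τ + 2 < |∑ m ∈ Finset.univ.erase p.1,
      (adj H p.2.1 m * adj H m p.2.2 - f (x p.2.1) (x m) * f (x m) (x p.2.2))|}
  have hsub : {H | ¬BiasBound b ε f h B x H} ⊆ ⋃ p, bad p := by
    intro H hH
    by_contra hc
    simp only [bad, mem_iUnion, mem_ofPred_eq, not_exists, not_and, not_lt] at hc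
    refine hH fun i j hg => ?_
    exact (biasBound_of_regular hf hη₀ hη hε hκ h2 hn ht (T := τ + 2) (by linarith) hx
      (fun j i l hil => hc (j, i, l) hil) hR hRη i j hg).trans hB
  have hbad : ∀ p, condProb f x (bad p) ≤ 2 * Real.exp (-2 * τ ^ 2 / n) := by
    rintro ⟨j, i, l⟩
    by_cases hil : i = l
    · have : bad (j, i, l) = ∅ := by
        ext H
        simp [bad, hil]
      rw [this]
      simp only [condProb, mem_empty_iff_false, if_false, Finset.sum_const_zero]
      positivity
    · exact (condProb_mono hf01 x fun H hH => hH.2).trans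
        (condProb_twoStep_le hf01 hf.symm x j hil hτ)
  refine (condProb_mono hf01 x hsub).trans ((condProb_iUnion_le hf01 x bad).trans
    ((Finset.sum_le_card_nsmul _ _ _ fun p _ => hbad p).trans (le_of_eq ?_)))
  simp only [Finset.card_univ, Fintype.card_prod, Fintype.card_fin, nsmul_eq_mul]
  push_cast
  ring

/-- The smoother is close to the edge probability unless the neighbourhood bias or the deviation
of the smoother from the local average is large. -/
theorem condProb_sub_smoother_le {f : I → I → ℝ} (hf : ∀ u v, f u v ∈ Icc (0 : ℝ) 1)
    (hsymm : ∀ u v, f u v = f v u) {K : ℕ} {b : Fin (K + 1) → ℝ} {ε : ℝ} (x : Fin n → I)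
    {i j : Fin n} (hg : GoodEdge b ε x i j) {h : ℕ} (h0 : 0 < h) (hn : h ≤ n - 2) {B₁ B₂ B : ℝ}
    (hB₂ : 0 ≤ B₂) (hB : B₁ + B₂ ≤ B) :
    condProb f x {H | B < |f (x i) (x j) - smoother H h i j|} ≤
      condProb f x {H | ¬BiasBound b ε f h B₁ x H} + 2 * Real.exp (-2 * h * B₂ ^ 2) := by
  have hh : (0 : ℝ) < h := by exact_mod_cast h0
  have h1 := condProb_smoother_le hf hsymm x hg.1 hn (t := h * B₂) (by positivity)
  have h2 : -2 * (h * B₂) ^ 2 / h = -2 * h * B₂ ^ 2 := by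
    field_simp
  rw [h2] at h1
  refine (condProb_mono hf x ?_).trans ((condProb_union_le hf x _ _).trans (add_le_add le_rfl h1))
  intro H hH
  by_contra hc
  simp only [mem_union, mem_ofPred_eq, not_or, not_not, not_lt] at hc hH
  obtain ⟨hc1, hc2⟩ := hc
  have h3 := hc1 i j hg
  have h4 : |localAverage f x H h i j - smoother H h i j| ≤ B₂ := by
    unfold localAverage smoother
    rw [← sub_div, ← Finset.sum_sub_distrib, abs_div, abs_of_pos hh, div_le_iff₀ hh, mul_comm,
      ← abs_neg, ← Finset.sum_neg_distrib]
    simpa using hc2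
  have h5 := abs_sub_le (f (x i) (x j)) (localAverage f x H h i j) (smoother H h i j)
  linarith

theorem condProb_not_biasBound_anti {f : I → I → ℝ} (hf : ∀ u v, f u v ∈ Icc (0 : ℝ) 1)
    {K : ℕ} {b : Fin (K + 1) → ℝ} {ε : ℝ} (x : Fin n → I) {h : ℕ} {B B' : ℝ} (hB : B ≤ B') :
    condProb f x {H | ¬BiasBound b ε f h B' x H} ≤ condProb f x {H | ¬BiasBound b ε f h B x H} :=
  condProb_mono hf x (ofPred_subset_ofPred.2 fun _ hH hc =>
    hH fun i j hg => (hc i j hg).trans hB)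

/-- When the widening is at least `1`, the bounds hold for all graphs. -/
theorem condProb_eq_zero_of_one_le {f : I → I → ℝ} (hf : ∀ u v, f u v ∈ Icc (0 : ℝ) 1)
    {K : ℕ} {b : Fin (K + 1) → ℝ} {ε : ℝ} (x : Fin n → I) {h : ℕ} (h0 : 0 < h) (hn : h ≤ n - 2)
    {B : ℝ} (hB : 1 ≤ B) :
    condProb f x {H | ¬BiasBound b ε f h B x H} = 0 ∧
      ∀ i j, i ≠ j → condProb f x {H | B < |f (x i) (x j) - smoother H h i j|} = 0 := by
  have hsub : ∀ {a c : ℝ}, a ∈ Icc (0 : ℝ) 1 → c ∈ Icc (0 : ℝ) 1 → |a - c| ≤ B := by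
    intro a c ha hc
    rw [abs_le]
    constructor <;> linarith [ha.1, ha.2, hc.1, hc.2]
  constructor
  · have : {H : SimpleGraph (Fin n) | ¬BiasBound b ε f h B x H} = ∅ := by
      refine eq_empty_of_forall_notMem fun H hH => hH fun i j hg => ?_
      exact abs_sub_localAverage_le hg.1 h0 hn fun k _ => hsub (hf _ _) (hf _ _)
    rw [this]
    simp [condProb]
  · intro i j hij
    have : {H : SimpleGraph (Fin n) | B < |f (x i) (x j) - smoother H h i j|} = ∅ :=
      eq_empty_of_forall_notMem fun H hH =>
        absurd (hsub (hf _ _) (smoother_mem_Icc H hij hn)) (not_le.2 hH)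
    rw [this]
    simp [condProb]

/-- For all large `n`, there is a set of latent positions of large probability on which the
conditional bounds hold. -/
theorem eventually_exists_latent_set {K : ℕ} {b : Fin (K + 1) → ℝ} (hb : IsPartition b)
    {η₀ L η δ : ℝ} (hη₀ : 0 < η₀) (hη : 0 < η) (hδ : 0 < δ) {κ : ℝ → ℝ}
    {ε : ℝ} (hε : 0 < ε) (hκ : 0 < κ ε)
    (hεb : ∀ m : Fin K, 2 * ε < b m.succ - b m.castSucc) {h : ℕ → ℕ}
    (hh : Asymptotics.IsTheta Filter.atTop (fun n : ℕ => (h n : ℝ))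
      (fun n : ℕ => Real.sqrt (n * Real.log n))) :
    ∃ C : ℝ, 0 < C ∧ ∀ᶠ n : ℕ in Filter.atTop, ∀ f : I → I → ℝ, IsBlockGraphon b η₀ L η δ κ f →
      2 ≤ h n → h n ≤ n - 2 →
      ∃ X : Set (Fin n → I), MeasurableSet X ∧ latentLaw n Xᶜ ≤ ENNReal.ofReal (2 / (n : ℝ) ^ 2) ∧
        (∀ x ∈ X, condProb f x {H | ¬BiasBound b ε f (h n) (C * rate n) x H} ≤ 2 / (n : ℝ) ^ 2) ∧
        ∀ x ∈ X, ∀ i j, GoodEdge b ε x i j →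
          condProb f x {H | C * rate n < |f (x i) (x j) - smoother H (h n) i j|} ≤
            2 / (n : ℝ) ^ 2 := by
  obtain ⟨Ch, hCh0, hCh⟩ := hh.1.exists_pos
  obtain ⟨Dh, hDh0, hDh⟩ := hh.2.exists_pos
  rw [Asymptotics.isBigOWith_iff] at hCh hDh
  -- The window radius is `C₁ * r ^ 2`. As `n - 1 ≥ n / 2`, its expected count is at least `(Ch + 4)
  -- * (n * r ^ 2)`: `Ch` pays for `h`, 2 for the fluctuation `τ`, and 2 for the two extra vertices.
  set C₁ : ℝ := 2 * (Ch + 4) with hC₁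
  -- The 69 is 64 from eight two-hop errors of at most `8 * r ^ 2`, 1 from `1 / n`, and 4 from the
  -- row error `s`.
  set C₃ : ℝ := 69 + 6 * (|L| * C₁) with hC₃
  have hC₁0 : 0 < C₁ := by positivity
  have hC₃0 : 0 < C₃ := by positivity
  set CB : ℝ := |L| * Real.sqrt (C₃ / κ ε) with hCB
  have hCB0 : 0 ≤ CB := by positivity
  -- Chosen so that `2 * h * (Cs * r) ^ 2 ≥ 4 * log n`.
  set Cs : ℝ := Real.sqrt (2 * Dh) with hCs
  have hCs0 : 0 < Cs := Real.sqrt_pos.2 (by positivity)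
  have hr2 : Filter.Tendsto (fun n => rate n ^ 2) Filter.atTop (nhds 0) := by
    simpa using tendsto_rate.pow 2
  -- Keeps twice the window radius below `2 * ε`, hence below every block length.
  have ev1 : ∀ᶠ n : ℕ in Filter.atTop, C₁ * rate n ^ 2 < ε :=
    (hr2.const_mul C₁).eventually_lt_const (by simpa using hε)
  have ev2 : ∀ᶠ n : ℕ in Filter.atTop, C₃ * rate n ^ 2 < η ^ 2 * δ :=
    (hr2.const_mul C₃).eventually_lt_const (by rw [mul_zero]; positivity)
  have ev3 : ∀ᶠ n : ℕ in Filter.atTop, rate n < 1 := tendsto_rate.eventually_lt_const one_pos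
  refine ⟨CB + Cs, by positivity, ?_⟩
  filter_upwards [hCh, hDh, ev1, ev2, ev3, Filter.eventually_ge_atTop 4] with
    n hnC hnD hn1 hn2 hn3 hn4 f hf h2 hn
  have hf01 := hf.mem_Icc hη₀
  set r := rate n with hr
  have hr0 : 0 < r := rate_pos (by omega)
  have hnr : (0 : ℝ) < n := by exact_mod_cast (by omega : 0 < n)
  have hn4' : (4 : ℝ) ≤ n := by exact_mod_cast hn4
  have hr4 : n * r ^ 4 = Real.log n := natCast_mul_rate_pow_four (by omega)
  have hsqrt : Real.sqrt (n * Real.log n) = n * r ^ 2 := sqrt_mul_log_eq (by omega)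
  rw [hsqrt] at hnC hnD
  rw [Real.norm_of_nonneg (Nat.cast_nonneg _), Real.norm_of_nonneg (by positivity)] at hnC hnD
  have hlog1 : 1 ≤ Real.log n := by
    rw [Real.le_log_iff_exp_le hnr]
    linarith [Real.exp_one_lt_d9]
  have hnr2 : 1 ≤ n * r ^ 2 := by
    have : n * r ^ 4 ≤ n * r ^ 2 :=
      mul_le_mul_of_nonneg_left (pow_le_pow_of_le_one hr0.le hn3.le (by norm_num)) hnr.le
    linarith
  have hinv : 1 / (n : ℝ) ≤ r ^ 2 := by
    rw [div_le_iff₀ hnr]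
    linarith
  -- Here `2 * τ ^ 2 / n = 8 * log n`; the resulting `n ^ (-8)` absorbs the union bounds over pairs
  -- and triples.
  set τ : ℝ := 2 * (n * r ^ 2) with hτ
  have hτ0 : 0 ≤ τ := by positivity
  have hexp : Real.exp (-2 * τ ^ 2 / n) = 1 / (n : ℝ) ^ 8 := by
    rw [← exp_neg_mul_log (by omega), ← hr4, hτ]
    congr 1
    field_simp
    push_cast
    ring
  have hpow : ∀ k : ℕ, (4 : ℝ) ^ k ≤ (n : ℝ) ^ k := fun k => pow_le_pow_left₀ (by norm_num) hn4' k
  have hn1pos : (0 : ℝ) < (n : ℝ) - 1 := by linarith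
  obtain ⟨X, hXm, hXreg, hXprob⟩ := exists_latentRegular (n := n) hb hf.measurable hf01
    (N := h n + 2) (t := C₁ * r ^ 2) (s := 4 * r ^ 2) (τ := τ) (by omega) (by positivity)
    (fun m => by linarith [hεb m]) hτ0
    (by
      push_cast
      have h1 : (n : ℝ) / 2 * (C₁ * r ^ 2) ≤ ((n : ℝ) - 1) * (C₁ * r ^ 2) :=
        mul_le_mul_of_nonneg_right (by linarith) (by positivity)
      have h2 : (n : ℝ) / 2 * (C₁ * r ^ 2) = Ch * (n * r ^ 2) + 4 * (n * r ^ 2) := by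
        rw [hC₁]
        ring
      linarith)
    (by
      rw [div_le_iff₀ hnr]
      linarith)
  have hbias : ∀ x ∈ X, condProb f x {H | ¬BiasBound b ε f (h n) (CB * r) x H} ≤
      1 / (n : ℝ) ^ 2 := by
    intro x hx
    refine (condProb_not_biasBound_le hf hη₀ hη hε hκ h2 hn (t := C₁ * r ^ 2) (s := 4 * r ^ 2)
      (τ := τ) (by positivity) hτ0 (hXreg x hx) (R := C₃ * r ^ 2) ?_ hn2 (le_of_eq ?_)).trans ?_
    · have h1 : (τ + 2) / ((n : ℝ) - 1) ≤ 8 * r ^ 2 := by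
        rw [div_le_iff₀ hn1pos]
        have : 8 * r ^ 2 * ((n : ℝ) / 2) ≤ 8 * r ^ 2 * ((n : ℝ) - 1) :=
          mul_le_mul_of_nonneg_left (by linarith) (by positivity)
        linarith
      rw [hC₃]
      linarith
    · rw [hCB, mul_div_right_comm, Real.sqrt_mul (by positivity), Real.sqrt_sq hr0.le, mul_assoc]
    · rw [hexp]
      have h5 : (2 : ℝ) ≤ n ^ 3 := by linarith [hpow 3]
      rw [show (n : ℝ) ^ 3 * (2 * (1 / (n : ℝ) ^ 8)) = 2 / (n : ℝ) ^ 3 * (1 / (n : ℝ) ^ 2) by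
        field_simp]
      exact mul_le_of_le_one_left (by positivity) ((div_le_one (by positivity)).2 h5)
  refine ⟨X, hXm, hXprob.trans (ENNReal.ofReal_le_ofReal ?_), fun x hx => ?_, fun x hx i j hg => ?_⟩
  · rw [hexp, mul_one_div, div_le_div_iff₀ (by positivity) (by positivity)]
    have h6 : (n : ℝ) ^ 2 + 2 * n ≤ 2 * (n : ℝ) ^ 6 := by
      have e1 : (n : ℝ) ≤ (n : ℝ) ^ 6 := le_self_pow₀ (by linarith) (by norm_num)
      have e2 : (n : ℝ) ^ 2 + 2 * n ≤ 2 * n ^ 2 := by nlinarith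
      have e3 : (n : ℝ) ^ 2 ≤ (n : ℝ) ^ 6 := pow_le_pow_right₀ (by linarith) (by norm_num)
      linarith
    calc ((n : ℝ) ^ 2 + 2 * n) * n ^ 2 ≤ (2 * (n : ℝ) ^ 6) * n ^ 2 := by gcongr
      _ = 2 * (n : ℝ) ^ 8 := by ring
  · refine (condProb_not_biasBound_anti hf01 x ?_).trans ((hbias x hx).trans (by gcongr; norm_num))
    exact mul_le_mul_of_nonneg_right (by linarith) hr0.le
  · refine (condProb_sub_smoother_le hf01 hf.symm x hg (by omega) hn (B₁ := CB * r) (B₂ := Cs * r)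
      (by positivity) (by linarith)).trans ?_
    have h7 : Real.exp (-2 * h n * (Cs * r) ^ 2) ≤ 1 / (n : ℝ) ^ 4 := by
      rw [← exp_neg_mul_log (by omega), Real.exp_le_exp, mul_pow, hCs,
        Real.sq_sqrt (by positivity), ← hr4]
      have : n * r ^ 2 * r ^ 2 ≤ Dh * h n * r ^ 2 := mul_le_mul_of_nonneg_right hnD (by positivity)
      push_cast
      nlinarith
    have h8 : 2 * (1 / (n : ℝ) ^ 4) ≤ 1 / (n : ℝ) ^ 2 := by
      have h5 : (2 : ℝ) ≤ n ^ 2 := by linarith [hpow 2]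
      rw [show 2 * (1 / (n : ℝ) ^ 4) = 2 / (n : ℝ) ^ 2 * (1 / (n : ℝ) ^ 2) by field_simp]
      exact mul_le_of_le_one_left (by positivity) ((div_le_one (by positivity)).2 h5)
    have h9 : 2 / (n : ℝ) ^ 2 = 1 / (n : ℝ) ^ 2 + 1 / (n : ℝ) ^ 2 := by ring
    linarith [hbias x hx]

theorem IsPartition.exists_block {K : ℕ} {b : Fin (K + 1) → ℝ} (hb : IsPartition b) :
    Nonempty (Fin K) := by
  rcases K with _ | K
  · have h1 := hb.first
    have h2 := hb.last
    rw [show Fin.last 0 = 0 from rfl, h1] at h2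
    norm_num at h2
  · exact ⟨0⟩

end LOO

/-! ### Assembly: large and small `n`. -/

theorem theorem3p1
    -- the model constants, the margin, the level and the bandwidth sequence
    (K : ℕ) (b : Fin (K + 1) → ℝ) (hb : LOO.IsPartition b)
    (η₀ L η δ : ℝ) (hη₀ : 0 < η₀) (hη₀' : η₀ < 1 / 2) (hη : 0 < η) (hδ : 0 < δ)
    (κ : ℝ → ℝ) (hκ : ∀ ε : ℝ, 0 < ε → 0 < κ ε)
    (ε : ℝ) (hε : 0 < ε) (hεb : ∀ m : Fin K, 2 * ε < b m.succ - b m.castSucc)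
    (α : ℝ) (hα : 0 < α) (hα' : α < 1)
    (h : ℕ → ℕ)
    (hh : Asymptotics.IsTheta Filter.atTop (fun n : ℕ => (h n : ℝ))
      (fun n : ℕ => Real.sqrt (n * Real.log n))) :
    ∃ C c : ℝ, 0 < C ∧ 0 < c ∧
      ∀ f : unitInterval → unitInterval → ℝ, LOO.IsBlockGraphon b η₀ L η δ κ f →
      ∀ n : ℕ, 2 ≤ h n → h n ≤ n - 2 →
      ∀ (Ω : Type*) [MeasurableSpace Ω] (μ : MeasureTheory.Measure Ω)
        [MeasureTheory.IsProbabilityMeasure μ]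
        (ξ : Ω → Fin n → unitInterval) (G : Ω → SimpleGraph (Fin n)),
        LOO.IsGraphonSample f μ ξ G →
        -- uniform bias bound over the good edges
        1 - (n : ℝ) ^ (-c) ≤
            μ.real {ω | LOO.BiasBound b ε f (h n) (C * LOO.rate n) (ξ ω) (G ω)} ∧
        -- coverage at each pair, given that it is a good edge
        (∀ i j : Fin n, i ≠ j →
          1 - α - (n : ℝ) ^ (-c) ≤
            (ProbabilityTheory.cond μ {ω | LOO.GoodEdge b ε (ξ ω) i j}).real
              {ω | LOO.Covers f (h n) α (C * LOO.rate n) i j (ξ ω) (G ω)}) ∧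
        -- the same two claims conditionally on the latent positions
        1 - (n : ℝ) ^ (-c) ≤
          μ.real {ω |
            1 - (n : ℝ) ^ (-c) ≤
                LOO.condProb f (ξ ω)
                  {H | LOO.BiasBound b ε f (h n) (C * LOO.rate n) (ξ ω) H} ∧
            ∀ i j : Fin n, LOO.GoodEdge b ε (ξ ω) i j →
              1 - α - (n : ℝ) ^ (-c) ≤
                LOO.condProb f (ξ ω)
                  {H | LOO.Covers f (h n) α (C * LOO.rate n) i j (ξ ω) H}} := by
  obtain ⟨C₀, hC₀, hlarge⟩ :=
    LOO.eventually_exists_latent_set (L := L) hb hη₀ hη hδ hε (hκ ε hε) hεb hh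
  obtain ⟨m₀⟩ := hb.exists_block
  set p : ℝ := (b m₀.succ - b m₀.castSucc - 2 * ε) ^ 2 with hp
  have hp0 : 0 < p := by
    have := hεb m₀
    exact pow_pos (by linarith) 2
  -- With `q = 2 / n ^ 2`, the requirement `2 * q / p ≤ 1 / n` is `n ≥ 4 / p`.
  obtain ⟨N, hN⟩ := Filter.eventually_atTop.1
    (hlarge.and (tendsto_natCast_atTop_atTop.eventually_ge_atTop (4 / p)))
  -- The sum forces `C * rate n ≥ 1` for `2 ≤ n < N`. At 0 and 1 the rate is zero, and so is its
  -- inverse by convention.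
  refine ⟨C₀ + ∑ k ∈ Finset.range N, (LOO.rate k)⁻¹, 1, ?_, one_pos, ?_⟩
  · exact add_pos_of_pos_of_nonneg hC₀
      (Finset.sum_nonneg fun k _ => inv_nonneg.2 (LOO.rate_nonneg k))
  intro f hf n h2 hn Ω _ μ _ ξ G hs
  set C : ℝ := C₀ + ∑ k ∈ Finset.range N, (LOO.rate k)⁻¹ with hC
  have hCC₀ : C₀ ≤ C := le_add_of_nonneg_right
    (Finset.sum_nonneg fun k _ => inv_nonneg.2 (LOO.rate_nonneg k))
  have hf01 := hf.mem_Icc hη₀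
  -- Truncated subtraction: `2 ≤ h n ≤ n - 2` is possible only for `n ≥ 4`.
  have hn4 : 4 ≤ n := by omega
  have hn4' : (4 : ℝ) ≤ n := by exact_mod_cast hn4
  have hnr : (0 : ℝ) < n := by linarith
  have hpow : (n : ℝ) ^ (-(1 : ℝ)) = 1 / n := by rw [Real.rpow_neg_one, one_div]
  rw [hpow]
  have hpE : ∀ i j : Fin n, i ≠ j →
      ENNReal.ofReal p ≤ LOO.latentLaw n {x | LOO.GoodEdge b ε x i j} :=
    fun i j hij => LOO.latentLaw_goodEdge_ge hb hε m₀ (hεb m₀) hij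
  rcases lt_or_ge n N with hnN | hnN
  · have hr := LOO.rate_pos (n := n) (by omega)
    have hone : 1 ≤ C * LOO.rate n := by
      have h1 : (LOO.rate n)⁻¹ ≤ ∑ k ∈ Finset.range N, (LOO.rate k)⁻¹ :=
        Finset.single_le_sum (f := fun k => (LOO.rate k)⁻¹)
          (fun k _ => inv_nonneg.2 (LOO.rate_nonneg k)) (Finset.mem_range.2 hnN)
      rw [← div_le_iff₀ hr, one_div]
      linarith
    have htriv := fun x : Fin n → unitInterval =>
      LOO.condProb_eq_zero_of_one_le (b := b) (ε := ε) hf01 x (h := h n) (by omega) hn hone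
    -- All quantities compared lie in `[0, 1]`, so the exceptional events are empty and `q = 0`
    -- works.
    exact hs.bias_and_coverage hf.measurable hf01 hα hα' h2 hn (X := Set.univ) MeasurableSet.univ
      le_rfl (by simp) (fun x _ => (htriv x).1.le) (fun x _ i j hg => ((htriv x).2 i j hg.1).le)
      hp0 hpE (by simp) (by simp)
  · obtain ⟨hlargen, hnp⟩ := hN n hnN
    obtain ⟨X, hXm, hX, hbias, hcov⟩ := hlargen f hf h2 hn
    have hmono : C₀ * LOO.rate n ≤ C * LOO.rate n :=
      mul_le_mul_of_nonneg_right hCC₀ (LOO.rate_nonneg n)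
    refine hs.bias_and_coverage hf.measurable hf01 hα hα' h2 hn hXm (by positivity) hX
      (fun x hx => ?_) (fun x hx i j hg => ?_) hp0 hpE ?_ ?_
    · exact (LOO.condProb_not_biasBound_anti hf01 x hmono).trans (hbias x hx)
    · exact (LOO.condProb_mono hf01 x fun H hH => hmono.trans_lt hH).trans (hcov x hx i j hg)
    · rw [mul_div_assoc', div_le_div_iff₀ (by positivity) hnr]
      nlinarith
    · rw [div_le_iff₀ hp0] at hnp
      rw [mul_div_assoc', div_div, div_le_div_iff₀ (by positivity) hnr]
      nlinarith
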